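/- **Setting.** Let $\Lambda$ be a set of indices. A Kripke frame is a set $W$ with binary relations $R_\lambda$ ($\lambda\in\Lambda$) on it. Modal formulas are built from propositional variables $p_0,p_1,\dots$ with $\bot,\to,\Diamond_\lambda$ (and $\Box_\lambda=\neg\Diamond_\lambda\neg$), with Kripke semantics; $\mathfrak F,w\models\varphi$ and $\mathfrak F\models\varphi$ denote validity (under all valuations) at a point and in the whole frame. First-order formulas are in the language with equality and the binary symbols $R_\lambda$. A *normal modal logic* is a set of modal formulas containing all propositional tautologies, the axioms $\Box_\lambda(p\to q)\to(\Box_\lambda p\to\Box_\lambda q)$ and $\Diamond_\lambda p\leftrightarrow\neg\Box_\lambda\neg p$, and closed under modus ponens, uniform substitution and necessitation. A set $\Sigma$ *axiomatises* $L$ if $L$ is the least normal modal logic containing $\Sigma$. A formula is *canonical* if it is valid in the canonical frame of the normal modal logic that it axiomatises. $\mathrm{Log}(\mathcal C)$ is the set of modal formulas valid in all frames of $\mathcal C$. A class of frames is *elementary* if it is defined by a single first-order sentence. A *generalised Sahlqvist formula* (Goranko–Vakarelov) is a formula built from positive formulas and negations of box-formulas by $\wedge,\vee,\Box_\lambda$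 (with $\varphi\to\psi$ read as $\neg\varphi\vee\psi$ and negations pushed inwards) whose dependency digraph is acyclic. Here a box-formula with head $p$ is built from the variable $p$ by the operations $B\mapsto\Box_\lambda B$ and $B\mapsto(A\to B)$ with $A$ positive; the variables in such $A$ are inessential; and the dependency digraph has an arrow from $q$ to $p$ whenever $q$ is inessential in a used box-formula with head $p$. A *rooted diagram* $\mathfrak D$ is a frame with finitely many points $x_0,\dots,x_n$ and finitely many edges $x_iR_\lambda x_j$ (triples $(x_i,\lambda,x_j)$) in which every point is reachable from the root $x_0$ by a directed path. Put $$\mathsf e^{\mathfrak D}(x_0)=\exists x_1\dots\exists x_n\bigwedge\{x_iR_\lambda x_j\mid x_iR^{\mathfrak D}_\lambda x_j\},$$ and define $\mathsf e^{\mathfrak D'}$ in the same way for the structures $\mathfrak D'$ obtained from $\mathfrak D$ by deleting edges. $\mathfrak D$ is *(globally) minimal* if for no $\mathfrak D'$ obtained from $\mathfrak D$ by deleting a single edge (with the same points and root; $\mathfrak D'$ need not be rooted) the sentence $\forall x_0\,\mathsf e^{\mathfrak D'}(x_0)\to\forall x_0\,\mathsf e^{\mathfrak D}(x_0)$ is a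 theorem of first-order logic. An *undirected cycle* is a closed walk of positive length along edges traversed in either direction in which no step is immediately followed by the traversal of the same edge backwards. **Theorem.** Let $\mathfrak D$ be a minimal rooted diagram that has an undirected cycle not passing through its root, and let $\mathcal C$ be the class of all Kripke frames validating $\forall x_0\,\mathsf e^{\mathfrak D}(x_0)$. Then none of the following ten statements holds. 1. There is a generalised Sahlqvist formula $\varphi$ that locally defines $\mathsf e^{\mathfrak D}(x_0)$, i.e. for all frames $\mathfrak F$ and points $w$: $\mathfrak F,w\models\varphi$ iff $\mathfrak F\models\mathsf e^{\mathfrak D}(w)$. 2. There is a modal formula that locally defines $\mathsf e^{\mathfrak D}(x_0)$. 3. There is a modal formula $\varphi$ such that for all frames $\mathfrak F$: $\mathfrak F\models\varphi$ iff $\mathfrak F\models\forall x_0\,\mathsf e^{\mathfrak D}(x_0)$. 4. $\mathrm{Log}(\mathcal C)$ is axiomatised by a generalised Sahlqvist formula. 5. $\mathrm{Log}(\mathcal C)$ is axiomatised by a finite set of modal formulas. 6. $\mathrm{Log}(\mathcal C)$ is axiomatised by a set of modal formulas in which only finitely many propositional variables occur. 7. $\mathrm{Log}(\mathcal C)$ is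 axiomatised by a set of canonical formulas. 8. $\mathrm{Log}(\mathcal C)$ is axiomatised by a modal formula together with a set of canonical formulas. 9. $\{\mathfrak F\mid\mathfrak F\models\mathrm{Log}(\mathcal C)\}=\mathcal C$. 10. $\{\mathfrak F\mid\mathfrak F\models\mathrm{Log}(\mathcal C)\}$ is elementary. -/

import Mathlib

universe u

namespace ModalDiagram

open FirstOrder

/-! ### Modal formulas -/

/-- Modal formulas over the index set `Λ`, with propositional variables `p_0, p_1, …`. -/
inductive ModalFormula (Λ : Type u) : Type u
  | var (p : ℕ) : ModalFormula Λ
  | bot : ModalFormula Λ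
  | imp (φ ψ : ModalFormula Λ) : ModalFormula Λ
  | dia (l : Λ) (φ : ModalFormula Λ) : ModalFormula Λ

namespace ModalFormula

variable {Λ : Type u}

/-- Negation, as an abbreviation. -/
abbrev neg (φ : ModalFormula Λ) : ModalFormula Λ := imp φ bot

/-- The box, as an abbreviation for `¬ ◇ ¬`. -/
abbrev box (l : Λ) (φ : ModalFormula Λ) : ModalFormula Λ := neg (dia l (neg φ))

/-- The set of propositional variables occurring in a formula. -/
def vars : ModalFormula Λ → Set ℕ
  | var p => {p}
  | bot => ∅
  | imp φ ψ => φ.vars ∪ ψ.vars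
  | dia _ φ => φ.vars

/-- Uniform substitution of formulas for propositional variables. -/
def subst (σ : ℕ → ModalFormula Λ) : ModalFormula Λ → ModalFormula Λ
  | var p => σ p
  | bot => bot
  | imp φ ψ => imp (φ.subst σ) (ψ.subst σ)
  | dia l φ => dia l (φ.subst σ)

/-- Every variable occurs in `φ` only under an even (for `true`), respectively odd (for `false`),
number of antecedents of implications; negation counts as an implication. -/
def Polarity : Bool → ModalFormula Λ → Prop
  | b, var _ => b = true
  | _, bot => True
  | b, imp φ ψ => Polarity (!b) φ ∧ Polarity b ψ
  | b, dia _ φ => Polarity b φ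

/-- Positive formulas. -/
def Positive (φ : ModalFormula Λ) : Prop := Polarity true φ

/-- Negative formulas. -/
def Negative (φ : ModalFormula Λ) : Prop := Polarity false φ

/-- `BoxFormula E p B`: `B` is a box-formula with head `p`, i.e. it is built from the variable `p`
by prefixing boxes and by prefixing antecedents that are positive formulas; and there is an
`E`-arrow to the head `p` from each variable that occurs in one of these antecedents
(the inessential variables of `B`). -/
inductive BoxFormula (E : ℕ → ℕ → Prop) (p : ℕ) : ModalFormula Λ → Prop
  | head : BoxFormula E p (var p)
  | imp {A B : ModalFormula Λ} : A.Positive → (∀ q ∈ A.vars, E q p) →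
      BoxFormula E p B → BoxFormula E p (A.imp B)
  | box (l : Λ) {B : ModalFormula Λ} : BoxFormula E p B → BoxFormula E p (box l B)

/-- With sign `true`: the regular formulas, built from positive formulas and negations of
box-formulas by conjunction, disjunction and boxes.  With sign `false`: the dual formulas, built
from negative formulas and box-formulas by conjunction, disjunction and diamonds.
As `→`, `⊥`, `◇` are the primitives, the closure conditions are given for these; an implication
`φ → ψ` is treated as `¬ φ ∨ ψ`, and negation exchanges the two signs, so that the closure under
`∧`, `∨` (for both signs), under `□` (for `true`) and under `◇` (for `false`) follows.
All dependencies between variables that arise from the box-formulas used are arrows of `E`. -/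
inductive Regular (E : ℕ → ℕ → Prop) : Bool → ModalFormula Λ → Prop
  | positive {φ : ModalFormula Λ} : φ.Positive → Regular E true φ
  | negative {φ : ModalFormula Λ} : φ.Negative → Regular E false φ
  | boxFormula {p : ℕ} {B : ModalFormula Λ} : BoxFormula E p B → Regular E false B
  | imp {b : Bool} {φ ψ : ModalFormula Λ} : Regular E (!b) φ → Regular E b ψ →
      Regular E b (φ.imp ψ)
  | dia (l : Λ) {φ : ModalFormula Λ} : Regular E false φ → Regular E false (dia l φ)

/-- Generalised Sahlqvist formulas in the sense of Goranko and Vakarelov (monadic inductive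
formulas): regular formulas whose dependency digraph has no directed cycles. -/
def GeneralisedSahlqvist (φ : ModalFormula Λ) : Prop :=
  ∃ E : ℕ → ℕ → Prop, (∀ p, ¬ Relation.TransGen E p p) ∧ Regular E true φ

/-- Propositional tautologies: formulas true under every Boolean evaluation that treats variables
and formulas `◇_λ φ` as atoms. -/
def Tautology (φ : ModalFormula Λ) : Prop :=
  ∀ e : ModalFormula Λ → Prop, ¬ e bot → (∀ χ ψ, e (imp χ ψ) ↔ (e χ → e ψ)) → e φ

end ModalFormula

open ModalFormula

variable {Λ : Type u}

/-! ### Kripke frames and validity -/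

/-- Kripke frames with relations indexed by `Λ`. -/
structure Frame (Λ : Type u) : Type (u + 1) where
  W : Type u
  R : Λ → W → W → Prop

/-- Truth of a modal formula at a point of a frame under a valuation. -/
def Frame.Truth (F : Frame Λ) (θ : ℕ → Set F.W) : F.W → ModalFormula Λ → Prop
  | w, .var p => w ∈ θ p
  | _, .bot => False
  | w, .imp φ ψ => F.Truth θ w φ → F.Truth θ w ψ
  | w, .dia l φ => ∃ y, F.R l w y ∧ F.Truth θ y φ

/-- Validity at a point. -/
def Frame.ValidAt (F : Frame Λ) (w : F.W) (φ : ModalFormula Λ) : Prop :=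
  ∀ θ : ℕ → Set F.W, F.Truth θ w φ

/-- Validity in a frame. -/
def Frame.Valid (F : Frame Λ) (φ : ModalFormula Λ) : Prop :=
  ∀ w : F.W, F.ValidAt w φ

/-- The logic `Log(C)` of a class of frames. -/
def Log (C : Set (Frame Λ)) : Set (ModalFormula Λ) :=
  {φ | ∀ F ∈ C, F.Valid φ}

/-- The class of all frames that validate every formula of `L`. -/
def FramesOf (L : Set (ModalFormula Λ)) : Set (Frame Λ) :=
  {F | ∀ φ ∈ L, F.Valid φ}

/-! ### Normal modal logics -/

/-- Normal modal logics.  The two formulas `◇_λ p → ¬ □_λ ¬ p` and `¬ □_λ ¬ p → ◇_λ p` are the usual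
duality axiom, which goes with axiom `K` when the diamond is the primitive connective. -/
structure IsNormalLogic (L : Set (ModalFormula Λ)) : Prop where
  taut : ∀ φ : ModalFormula Λ, φ.Tautology → φ ∈ L
  axiomK : ∀ l : Λ, (box l ((var 0).imp (var 1))).imp ((box l (var 0)).imp (box l (var 1))) ∈ L
  dual : ∀ l : Λ, (dia l (var 0)).imp (neg (box l (neg (var 0)))) ∈ L
  dual' : ∀ l : Λ, (neg (box l (neg (var 0)))).imp (dia l (var 0)) ∈ L
  mp : ∀ φ ψ : ModalFormula Λ, φ ∈ L → φ.imp ψ ∈ L → ψ ∈ L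
  subst : ∀ (φ : ModalFormula Λ) (σ : ℕ → ModalFormula Λ), φ ∈ L → φ.subst σ ∈ L
  nec : ∀ (l : Λ) (φ : ModalFormula Λ), φ ∈ L → box l φ ∈ L

/-- `S` axiomatises `L`: `L` is the least normal modal logic containing `Σ`. -/
def Axiomatises (S L : Set (ModalFormula Λ)) : Prop :=
  IsLeast {L' | IsNormalLogic L' ∧ S ⊆ L'} L

/-- The normal modal logic `K + S`. -/
def normalLogic (S : Set (ModalFormula Λ)) : Set (ModalFormula Λ) :=
  ⋂₀ {L' | IsNormalLogic L' ∧ S ⊆ L'}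

/-- `Γ` is `L`-consistent: `L` contains no formula `φ₁ → (φ₂ → … → (φₙ → ⊥))`
with all `φᵢ` in `Γ`. -/
def Consistent (L Γ : Set (ModalFormula Λ)) : Prop :=
  ∀ l : List (ModalFormula Λ), (∀ φ ∈ l, φ ∈ Γ) → l.foldr imp bot ∉ L

/-- The canonical frame of `L`: its points are the maximal `L`-consistent sets. -/
def canonicalFrame (L : Set (ModalFormula Λ)) : Frame Λ where
  W := {Γ : Set (ModalFormula Λ) // Maximal (Consistent L) Γ}
  R l Γ Δ := ∀ φ ∈ Δ.1, dia l φ ∈ Γ.1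

/-- A formula is canonical if it is valid in the canonical frame of the logic it axiomatises. -/
def Canonical (φ : ModalFormula Λ) : Prop :=
  (canonicalFrame (normalLogic {φ})).Valid φ

/-! ### The first-order language of frames -/

/-- The relation symbols: one binary symbol for each `λ`. -/
inductive FrameRel (Λ : Type u) : ℕ → Type u
  | rel (l : Λ) : FrameRel Λ 2

/-- The first-order language (with equality) of Kripke frames. -/
def frameLang (Λ : Type u) : FirstOrder.Language.{0, u} := ⟨fun _ => Empty, FrameRel Λ⟩

/-- A Kripke frame as a first-order structure. -/
instance Frame.structure (F : Frame Λ) : (frameLang Λ).Structure F.W where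
  funMap f := f.elim
  RelMap r := match r with
    | .rel l => fun v => F.R l (v 0) (v 1)

/-- The class of frames in which a first-order sentence is true. -/
def Mod (a : (frameLang Λ).Sentence) : Set (Frame Λ) := {F | F.W ⊨ a}

/-- A class of frames is elementary if it is defined by a single first-order sentence. -/
def Elementary (K : Set (Frame Λ)) : Prop := ∃ a : (frameLang Λ).Sentence, K = Mod a

/-- The modal formula `φ` locally defines the first-order formula `a(x)`. -/
def LocallyDefines (φ : ModalFormula Λ) (a : (frameLang Λ).Formula Unit) : Prop :=
  ∀ (F : Frame Λ) (w : F.W), F.ValidAt w φ ↔ a.Realize (fun _ => w)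

/-- The modal formula `φ` globally defines the first-order sentence `a`. -/
def GloballyDefines (φ : ModalFormula Λ) (a : (frameLang Λ).Sentence) : Prop :=
  ∀ F : Frame Λ, F.Valid φ ↔ F.W ⊨ a

/-! ### Diagrams -/

/-- A finite pointed frame with finitely many edges `x R_λ y` in total (so that the conjunction of
all its edges is a first-order formula).  Rootedness is the separate condition `Rooted`, as it may
be lost when an edge is deleted. -/
structure Diagram (Λ : Type u) : Type (u + 1) extends Frame Λ where
  root : W
  finite_points : Finite W
  finite_edges : {t : W × Λ × W | R t.2.1 t.1 t.2.2}.Finite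

namespace Diagram

variable (D : Diagram Λ)

/-- Every point is reachable from the root by a directed path. -/
def Rooted : Prop := ∀ y : D.W, Relation.ReflTransGen (fun a b => ∃ l, D.R l a b) D.root y

/-- The conjunction of all atoms `x R_λ y` that hold in the diagram; its variables are the points
of the diagram. -/
noncomputable def kFormula : (frameLang Λ).Formula D.W :=
  haveI := D.finite_edges.to_subtype
  FirstOrder.Language.Formula.iInf fun t : {t : D.W × Λ × D.W | D.R t.2.1 t.1 t.2.2} =>
    FirstOrder.Language.Relations.formula₂ (L := frameLang Λ) (FrameRel.rel t.1.2.1)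
      (FirstOrder.Language.Term.var t.1.1) (FirstOrder.Language.Term.var t.1.2.2)

open Classical in
/-- The formula `e(x₀)`: all points except the root are existentially quantified in `kFormula`,
and the root is the only free variable. -/
noncomputable def eFormula : (frameLang Λ).Formula Unit :=
  haveI := D.finite_points
  FirstOrder.Language.Formula.iExs {x : D.W // x ≠ D.root} <|
    D.kFormula.relabel fun x => if h : x = D.root then Sum.inl () else Sum.inr ⟨x, h⟩

/-- The sentence `∀ x₀ e(x₀)`. -/
noncomputable def eSentence : (frameLang Λ).Sentence :=
  FirstOrder.Language.Formula.iAlls Unit (D.eFormula.relabel (Sum.inr : Unit → Empty ⊕ Unit))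

/-- `e(x₀)` holds at `w` exactly if there is a homomorphism from the diagram that sends the root
to `w`. -/
theorem realize_eFormula (F : Frame Λ) (w : F.W) :
    D.eFormula.Realize (fun _ => w) ↔
      ∃ f : D.W → F.W, f D.root = w ∧ ∀ l x y, D.R l x y → F.R l (f x) (f y) := by
  classical
  have key : ∀ v : D.W → F.W,
      D.kFormula.Realize v ↔ ∀ l x y, D.R l x y → F.R l (v x) (v y) := by
    intro v
    have := D.finite_edges.to_subtype
    unfold kFormula
    rw [FirstOrder.Language.Formula.realize_iInf]
    constructor
    · intro h l x y hxy
      exact (FirstOrder.Language.Formula.realize_rel₂ (L := frameLang Λ)).1 (h ⟨(x, l, y), hxy⟩)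
    · rintro h ⟨⟨x, l, y⟩, hxy⟩
      exact (FirstOrder.Language.Formula.realize_rel₂ (L := frameLang Λ)).2 (h l x y hxy)
  have := D.finite_points
  unfold eFormula
  rw [FirstOrder.Language.Formula.realize_iExs]
  simp only [FirstOrder.Language.Formula.realize_relabel, key]
  constructor
  · rintro ⟨i, hi⟩
    exact ⟨_, by simp, hi⟩
  · rintro ⟨f, hf, h⟩
    refine ⟨fun x => f x.1, ?_⟩
    have : (Sum.elim (fun _ : Unit => w) (fun x : {x : D.W // x ≠ D.root} => f x.1) ∘
        fun x => if h : x = D.root then Sum.inl () else Sum.inr ⟨x, h⟩) = f := by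
      funext x
      by_cases hx : x = D.root
      · simp [hx, hf]
      · simp [hx]
    rw [this]
    exact h

theorem realize_eSentence (F : Frame Λ) :
    F.W ⊨ D.eSentence ↔
      ∀ w : F.W, ∃ f : D.W → F.W, f D.root = w ∧ ∀ l x y, D.R l x y → F.R l (f x) (f y) := by
  unfold eSentence FirstOrder.Language.Sentence.Realize
  rw [FirstOrder.Language.Formula.realize_iAlls]
  simp only [FirstOrder.Language.Formula.realize_relabel, ← realize_eFormula]
  constructor
  · intro h w
    exact h fun _ => w
  · intro h i
    exact h (i ())

/-- The diagram obtained by deleting the edge `x R_l y`. -/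
def deleteEdge (x : D.W) (l : Λ) (y : D.W) : Diagram Λ where
  W := D.W
  R m a b := D.R m a b ∧ ¬ (m = l ∧ a = x ∧ b = y)
  root := D.root
  finite_points := D.finite_points
  finite_edges := D.finite_edges.subset fun _ h => h.1

/-- Global minimality: no edge can be deleted such that, for the diagram `D'` so obtained,
`∀ x₀ e^{D'}(x₀)` still implies `∀ x₀ e^D(x₀)` in first-order logic. -/
def GloballyMinimal : Prop :=
  ∀ (x : D.W) (l : Λ) (y : D.W), D.R l x y →
    ¬ ((∅ : (frameLang Λ).Theory) ⊨ᵇ (D.deleteEdge x l y).eSentence.imp D.eSentence)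

/-- One step of an undirected path: `(l, true)` traverses an edge `R_l` forwards and `(l, false)`
traverses it backwards. -/
def UStep : Λ × Bool → D.W → D.W → Prop
  | (l, true), x, y => D.R l x y
  | (l, false), x, y => D.R l y x

/-- `z 0, s 0, z 1, s 1, …, s (h - 1), z h` is an undirected cycle: a closed undirected path of
positive length in which no step is immediately followed by its reversal. -/
def IsUndirectedCycle (h : ℕ) (z : ℕ → D.W) (s : ℕ → Λ × Bool) : Prop :=
  0 < h ∧ (∀ i < h, D.UStep (s i) (z i) (z (i + 1))) ∧ z h = z 0 ∧
    ∀ i, i + 1 < h → ¬ (z (i + 2) = z i ∧ s (i + 1) = ((s i).1, !(s i).2))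

/-- There is an undirected cycle that does not pass through the root. -/
def HasInnerCycle : Prop :=
  ∃ (h : ℕ) (z : ℕ → D.W) (s : ℕ → Λ × Bool), D.IsUndirectedCycle h z s ∧ ∀ i ≤ h, z i ≠ D.root

/-- The class of all frames validating `∀ x₀ e(x₀)`. -/
noncomputable def frameClass : Set (Frame Λ) := Mod D.eSentence

end Diagram

end ModalDiagram

/-! Graph colouring is encoded in frames. Minimality yields a finite frame `B` (`exists_base`) with
a copy of the diagram such that e(x₀) holds at every point other than the root of the copy, and
every homomorphism at that root must use all edges of the copy. Let `e` be an edge on a cycle off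
the root. For a graph `E` on `I`, the frame `B.twist e E` lives on `P × I`: copy edges off the root
keep the index, except that `e` moves it along `E`. Following the rest of the cycle brings the index
back, so e(x₀) holds at the copies of the root exactly if `E` has a loop (`homAt_twist_of_loop`,
`exists_loop_of_homAt`).

For loopless graphs the logic sees chromatic numbers. Each formula of the logic is valid over all
graphs that are not colourable with a certain number of colours (`exists_valid_twist`): colour an
index by the subformulas true at the target of `e` with that index; along a monochromatic edge a
loop can be created without changing truth. Conversely, for each `s > 0` one formula of the logic
fails over all nonempty `s`-colourable graphs (`exists_refuted_twist`).

The infinite complete graph thus gives a frame of the logic outside the class, which excludes modal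
definability; a first-order sentence true there is also true over a finite complete graph, which
excludes elementarity. Formulas of the logic in finitely many variables are all valid over some
finite complete graph, which excludes axiomatisations with finitely many variables, in particular
finite ones. For canonical axioms, `exists_graphTower` supplies finite graphs of large chromatic
number and growing odd girth. Their inverse limit is bipartite, but canonical formulas valid over
the finite graphs remain valid over it (`valid_of_canonical`). A disjoint complete graph keeps one
further axiom valid while the number of colours stays bounded. -/

namespace ModalDiagram

open ModalFormula

variable {Λ : Type u}

/-! ### Truth, validity and normal logics -/

namespace ModalFormula

/-- The subformulas of a formula. -/
def subformulas : ModalFormula Λ → Set (ModalFormula Λ)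
  | var p => {var p}
  | bot => {bot}
  | imp φ ψ => insert (imp φ ψ) (φ.subformulas ∪ ψ.subformulas)
  | dia l φ => insert (dia l φ) φ.subformulas

theorem finite_subformulas (φ : ModalFormula Λ) : φ.subformulas.Finite := by
  induction φ with
  | var p => exact Set.finite_singleton _
  | bot => exact Set.finite_singleton _
  | imp φ ψ h₁ h₂ => exact (h₁.union h₂).insert _
  | dia l φ h => exact h.insert _

theorem self_mem_subformulas (φ : ModalFormula Λ) : φ ∈ φ.subformulas := by
  cases φ <;> simp [subformulas]

theorem finite_vars (φ : ModalFormula Λ) : φ.vars.Finite := by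
  induction φ with
  | var p => exact Set.finite_singleton _
  | bot => exact Set.finite_empty
  | imp φ ψ h₁ h₂ => exact h₁.union h₂
  | dia l φ h => exact h

/-- A set of formulas is closed under subformulas. -/
structure SubformulaClosed (Φ : Set (ModalFormula Λ)) : Prop where
  left : ∀ φ ψ, imp φ ψ ∈ Φ → φ ∈ Φ
  right : ∀ φ ψ, imp φ ψ ∈ Φ → ψ ∈ Φ
  dia : ∀ l φ, dia l φ ∈ Φ → φ ∈ Φ

theorem subformulaClosed_subformulas (φ : ModalFormula Λ) : SubformulaClosed φ.subformulas := by
  induction φ with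
  | var p => constructor <;> simp [subformulas]
  | bot => constructor <;> simp [subformulas]
  | imp α β h₁ h₂ =>
    constructor
    · rintro φ ψ (h | h | h)
      · cases h; exact Or.inr (Or.inl (self_mem_subformulas _))
      · exact Or.inr (Or.inl (h₁.left _ _ h))
      · exact Or.inr (Or.inr (h₂.left _ _ h))
    · rintro φ ψ (h | h | h)
      · cases h; exact Or.inr (Or.inr (self_mem_subformulas _))
      · exact Or.inr (Or.inl (h₁.right _ _ h))
      · exact Or.inr (Or.inr (h₂.right _ _ h))
    · rintro l φ (h | h | h)
      · cases h
      · exact Or.inr (Or.inl (h₁.dia _ _ h))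
      · exact Or.inr (Or.inr (h₂.dia _ _ h))
  | dia m α h₁ =>
    constructor
    · rintro φ ψ (h | h)
      · cases h
      · exact Or.inr (h₁.left _ _ h)
    · rintro φ ψ (h | h)
      · cases h
      · exact Or.inr (h₁.right _ _ h)
    · rintro l φ (h | h)
      · cases h; exact Or.inr (self_mem_subformulas _)
      · exact Or.inr (h₁.dia _ _ h)

theorem subformulaClosed_vars_subset (V : Set ℕ) :
    SubformulaClosed {φ : ModalFormula Λ | φ.vars ⊆ V} where
  left _ _ h := Set.subset_union_left.trans h
  right _ _ h := Set.subset_union_right.trans h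
  dia _ _ h := h

end ModalFormula

namespace Frame

variable {F G : Frame Λ}

theorem truth_subst (θ : ℕ → Set F.W) (σ : ℕ → ModalFormula Λ) (φ : ModalFormula Λ) (w : F.W) :
    F.Truth θ w (φ.subst σ) ↔ F.Truth (fun n => {y | F.Truth θ y (σ n)}) w φ := by
  induction φ generalizing w with
  | var p => rfl
  | bot => rfl
  | imp φ ψ h₁ h₂ => simp only [subst, Truth, h₁, h₂]
  | dia l φ h => simp only [subst, Truth, h]

theorem truth_foldr_imp_bot (θ : ℕ → Set F.W) (w : F.W) (l : List (ModalFormula Λ)) :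
    F.Truth θ w (l.foldr imp bot) ↔ ¬ ∀ φ ∈ l, F.Truth θ w φ := by
  induction l with
  | nil => simp [Truth]
  | cons a l h => simp only [List.foldr_cons, Truth, h, List.forall_mem_cons, not_and]

theorem truth_box (θ : ℕ → Set F.W) (w : F.W) (l : Λ) (φ : ModalFormula Λ) :
    F.Truth θ w (box l φ) ↔ ∀ y, F.R l w y → F.Truth θ y φ := by
  simp [Truth]

/-- Truth is preserved along a bounded morphism, for valuations that agree on the variables. -/
theorem truth_boundedMorphism (f : F.W → G.W)
    (hom : ∀ l x y, F.R l x y → G.R l (f x) (f y))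
    (back : ∀ l x v, G.R l (f x) v → ∃ y, F.R l x y ∧ f y = v)
    (θ : ℕ → Set F.W) (η : ℕ → Set G.W) (φ : ModalFormula Λ)
    (hv : ∀ p ∈ φ.vars, ∀ x, x ∈ θ p ↔ f x ∈ η p) (x : F.W) :
    F.Truth θ x φ ↔ G.Truth η (f x) φ := by
  induction φ generalizing x with
  | var p => exact hv p rfl x
  | bot => rfl
  | imp φ ψ h₁ h₂ =>
    simp only [Truth, h₁ (fun p hp => hv p (Or.inl hp)), h₂ (fun p hp => hv p (Or.inr hp))]
  | dia l φ h =>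
    simp only [Truth, h hv]
    constructor
    · rintro ⟨y, hy, ht⟩
      exact ⟨_, hom _ _ _ hy, ht⟩
    · rintro ⟨v, hv, ht⟩
      obtain ⟨y, hy, rfl⟩ := back _ _ _ hv
      exact ⟨y, hy, ht⟩

/-- The formulas true everywhere under all valuations of a class that is closed under definability
form a normal logic. -/
theorem isNormalLogic_of_valuations (F : Frame Λ) (V : Set (ℕ → Set F.W))
    (hV : ∀ θ ∈ V, ∀ σ : ℕ → ModalFormula Λ, (fun n => {y | F.Truth θ y (σ n)}) ∈ V) :
    IsNormalLogic {φ | ∀ θ ∈ V, ∀ w, F.Truth θ w φ} where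
  taut φ h θ _ w := h (F.Truth θ w) id fun _ _ => Iff.rfl
  axiomK l θ _ w := fun h₁ h₂ => (truth_box θ w l _).2 fun y hy =>
    (truth_box θ w l _).1 h₁ y hy ((truth_box θ w l _).1 h₂ y hy)
  dual l θ _ w := by simp [Truth]
  dual' l θ _ w := by simp [Truth]
  mp φ ψ h₁ h₂ θ hθ w := h₂ θ hθ w (h₁ θ hθ w)
  subst φ σ h θ hθ w := (truth_subst θ σ φ w).2 (h _ (hV θ hθ σ) w)
  nec l φ h θ hθ w := (truth_box θ w l φ).2 fun y _ => h θ hθ y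

theorem isNormalLogic_valid (F : Frame Λ) : IsNormalLogic {φ | F.Valid φ} := by
  have := F.isNormalLogic_of_valuations Set.univ fun _ _ _ => trivial
  have e : {φ | F.Valid φ} = {φ | ∀ θ ∈ Set.univ, ∀ w, F.Truth θ w φ} := by
    ext φ
    exact ⟨fun h θ _ w => h w θ, fun h w θ => h θ trivial w⟩
  rwa [e]

end Frame

theorem isNormalLogic_normalLogic (S : Set (ModalFormula Λ)) : IsNormalLogic (normalLogic S) where
  taut φ h _ hL := hL.1.taut φ h
  axiomK l _ hL := hL.1.axiomK l
  dual l _ hL := hL.1.dual l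
  dual' l _ hL := hL.1.dual' l
  mp φ ψ h₁ h₂ L hL := hL.1.mp φ ψ (h₁ L hL) (h₂ L hL)
  subst φ σ h L hL := hL.1.subst φ σ (h L hL)
  nec l φ h L hL := hL.1.nec l φ (h L hL)

theorem subset_normalLogic (S : Set (ModalFormula Λ)) : S ⊆ normalLogic S :=
  fun _ h _ hL => hL.2 h

theorem normalLogic_mono {S T : Set (ModalFormula Λ)} (h : S ⊆ T) :
    normalLogic S ⊆ normalLogic T :=
  fun _ hφ L hL => hφ L ⟨hL.1, h.trans hL.2⟩

theorem Frame.valid_normalLogic {F : Frame Λ} {S : Set (ModalFormula Λ)}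
    (h : ∀ φ ∈ S, F.Valid φ) : ∀ φ ∈ normalLogic S, F.Valid φ :=
  fun _ hφ => hφ _ ⟨F.isNormalLogic_valid, h⟩

theorem Axiomatises.subset_normalLogic {S L : Set (ModalFormula Λ)} (h : Axiomatises S L) :
    L ⊆ normalLogic S :=
  h.2 ⟨isNormalLogic_normalLogic S, ModalDiagram.subset_normalLogic S⟩

theorem Axiomatises.subset {S L : Set (ModalFormula Λ)} (h : Axiomatises S L) : S ⊆ L := h.1.2

/-- A formula of `K + S` is derivable from finitely many members of `S`. -/
theorem exists_finite_of_mem_normalLogic {S : Set (ModalFormula Λ)} {φ : ModalFormula Λ}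
    (h : φ ∈ normalLogic S) : ∃ T : Set (ModalFormula Λ), T.Finite ∧ T ⊆ S ∧ φ ∈ normalLogic T := by
  refine h {φ | ∃ T : Set (ModalFormula Λ), T.Finite ∧ T ⊆ S ∧ φ ∈ normalLogic T} ⟨?_, ?_⟩
  · have hN := fun T : Set (ModalFormula Λ) => isNormalLogic_normalLogic T
    constructor
    · exact fun φ h => ⟨∅, Set.finite_empty, Set.empty_subset _, (hN _).taut φ h⟩
    · exact fun l => ⟨∅, Set.finite_empty, Set.empty_subset _, (hN _).axiomK l⟩
    · exact fun l => ⟨∅, Set.finite_empty, Set.empty_subset _, (hN _).dual l⟩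
    · exact fun l => ⟨∅, Set.finite_empty, Set.empty_subset _, (hN _).dual' l⟩
    · rintro φ ψ ⟨T₁, f₁, s₁, h₁⟩ ⟨T₂, f₂, s₂, h₂⟩
      exact ⟨T₁ ∪ T₂, f₁.union f₂, Set.union_subset s₁ s₂, (hN _).mp φ ψ
        (normalLogic_mono Set.subset_union_left h₁) (normalLogic_mono Set.subset_union_right h₂)⟩
    · rintro φ σ ⟨T, f, s, h⟩
      exact ⟨T, f, s, (hN _).subst φ σ h⟩
    · rintro l φ ⟨T, f, s, h⟩
      exact ⟨T, f, s, (hN _).nec l φ h⟩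
  · exact fun φ h => ⟨{φ}, Set.finite_singleton _, by simpa using h,
      ModalDiagram.subset_normalLogic _ rfl⟩

/-! ### Maximal consistent sets -/

theorem eval_foldr_imp_bot {e : ModalFormula Λ → Prop} (h₀ : ¬ e bot)
    (h₁ : ∀ χ ψ, e (imp χ ψ) ↔ (e χ → e ψ)) (l : List (ModalFormula Λ)) :
    e (l.foldr imp bot) ↔ ¬ ∀ φ ∈ l, e φ := by
  induction l with
  | nil => simp [h₀]
  | cons a l h => simp only [List.foldr_cons, h₁, h, List.forall_mem_cons, not_and]

theorem IsNormalLogic.mem_or_neg_mem {L : Set (ModalFormula Λ)} (hL : IsNormalLogic L)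
    {Γ : Set (ModalFormula Λ)} (hΓ : Maximal (Consistent L) Γ) (χ : ModalFormula Λ) :
    χ ∈ Γ ∨ neg χ ∈ Γ := by
  classical
  by_contra hcon
  push Not at hcon
  have key : ∀ ψ, ψ ∉ Γ → ∃ l : List (ModalFormula Λ), (∀ φ ∈ l, φ ∈ insert ψ Γ) ∧
      l.foldr imp bot ∈ L := by
    intro ψ hψ
    by_contra hc
    push Not at hc
    exact hψ (hΓ.2 (y := insert ψ Γ) hc (Set.subset_insert _ _) (Set.mem_insert _ _))
  obtain ⟨l₁, h₁, d₁⟩ := key _ hcon.1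
  obtain ⟨l₂, h₂, d₂⟩ := key _ hcon.2
  have hl : ∀ φ ∈ l₁.filter (· ≠ χ) ++ l₂.filter (· ≠ neg χ), φ ∈ Γ := by
    intro φ hφ
    simp only [List.mem_append, List.mem_filter, decide_eq_true_eq] at hφ
    rcases hφ with ⟨h, hne⟩ | ⟨h, hne⟩
    · exact (h₁ _ h).resolve_left hne
    · exact (h₂ _ h).resolve_left hne
  refine hΓ.1 _ hl (hL.mp _ _ d₂ (hL.mp _ _ d₁ (hL.taut _ ?_)))
  intro e h0 h1
  rw [h1, h1, eval_foldr_imp_bot h0 h1, eval_foldr_imp_bot h0 h1, eval_foldr_imp_bot h0 h1]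
  intro H₁ H₂ H
  have hχ : ¬ e χ := by
    intro hc
    refine H₁ fun φ hφ => ?_
    by_cases hne : φ = χ
    · rwa [hne]
    · exact H _ (by simp [hφ, hne])
  refine H₂ fun φ hφ => ?_
  by_cases hne : φ = neg χ
  · rw [hne, h1]; exact fun h => absurd h hχ
  · exact H _ (List.mem_append_right _ (by simpa [hφ] using hne))

theorem IsNormalLogic.neg_foldr_mem {L : Set (ModalFormula Λ)} (hL : IsNormalLogic L)
    {Γ : Set (ModalFormula Λ)} (hΓ : Maximal (Consistent L) Γ) {l : List (ModalFormula Λ)}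
    (hl : ∀ φ ∈ l, φ ∈ Γ) : neg (l.foldr imp bot) ∈ Γ := by
  refine (hL.mem_or_neg_mem hΓ _).resolve_left fun hmem => ?_
  refine hΓ.1 (l.foldr imp bot :: l) ?_ (hL.taut _ fun e _ h1 => ?_)
  · simpa [hmem] using hl
  · simp [h1]

/-! ### Inverse limits of finite frames and canonical formulas -/

/-- `F` is the inverse limit of the finite frames `G k` along bounded morphisms, with projections
`ρ k`. -/
structure IsFiniteLimit (F : Frame Λ) (G : ℕ → Frame Λ) (ρ : ∀ k, F.W → (G k).W) : Prop where
  finite : ∀ k, Finite (G k).W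
  hom : ∀ k l x y, F.R l x y → (G k).R l (ρ k x) (ρ k y)
  back : ∀ k l x v, (G k).R l (ρ k x) v → ∃ y, F.R l x y ∧ ρ k y = v
  factor : ∀ k, ∃ π : (G (k + 1)).W → (G k).W, ∀ x, ρ k x = π (ρ (k + 1) x)
  complete : ∀ v : ∀ k, (G k).W, (∀ k, ∃ z, ∀ j ≤ k, ρ j z = v j) → ∃ y, ∀ k, ρ k y = v k
  inj : ∀ x y, (∀ k, ρ k x = ρ k y) → x = y
  full : ∀ l x y, (∀ k, (G k).R l (ρ k x) (ρ k y)) → F.R l x y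

namespace IsFiniteLimit

variable {F : Frame Λ} {G : ℕ → Frame Λ} {ρ : ∀ k, F.W → (G k).W}

theorem factor_le (h : IsFiniteLimit F G ρ) {j k : ℕ} (hjk : j ≤ k) :
    ∃ π : (G k).W → (G j).W, ∀ x, ρ j x = π (ρ k x) := by
  induction k, hjk using Nat.le_induction with
  | base => exact ⟨id, fun _ => rfl⟩
  | succ k _ ih =>
    obtain ⟨π, hπ⟩ := ih
    obtain ⟨π', hπ'⟩ := h.factor k
    exact ⟨π ∘ π', fun x => by rw [hπ, hπ']; rfl⟩

/-- The sets that come from one of the finite frames. -/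
def Clopen (ρ : ∀ k, F.W → (G k).W) (A : Set F.W) : Prop :=
  ∃ (k : ℕ) (U : Set (G k).W), A = ρ k ⁻¹' U

/-- A formula has finitely many variables, so under a clopen valuation its truth can be computed in
a single finite frame. -/
theorem exists_level (h : IsFiniteLimit F G ρ) (θ : ℕ → Set F.W) {V : Set ℕ} (hV : V.Finite)
    (hθ : ∀ n ∈ V, Clopen ρ (θ n)) :
    ∃ (k : ℕ) (η : ℕ → Set (G k).W), ∀ n ∈ V, ∀ x, x ∈ θ n ↔ ρ k x ∈ η n := by
  classical
  have H : ∀ n, ∃ k, ∀ m ≥ k, n ∈ V → ∃ U : Set (G m).W, ∀ x, x ∈ θ n ↔ ρ m x ∈ U := by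
    intro n
    by_cases hn : n ∈ V
    · obtain ⟨k, U, hU⟩ := hθ n hn
      refine ⟨k, fun m hm _ => ?_⟩
      obtain ⟨π, hπ⟩ := h.factor_le hm
      exact ⟨π ⁻¹' U, fun x => by rw [hU, Set.mem_preimage, Set.mem_preimage, hπ]⟩
    · exact ⟨0, fun _ _ h => absurd h hn⟩
  choose K hK using H
  obtain ⟨k, hk⟩ := (hV.image K).bddAbove
  have H' : ∀ n, ∃ U : Set (G k).W, n ∈ V → ∀ x, x ∈ θ n ↔ ρ k x ∈ U := by
    intro n
    by_cases hn : n ∈ V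
    · obtain ⟨U, hU⟩ := hK n k (hk ⟨n, hn, rfl⟩) hn
      exact ⟨U, fun _ => hU⟩
    · exact ⟨∅, fun h => absurd h hn⟩
  choose η hη using H'
  exact ⟨k, η, hη⟩

theorem clopen_truth (h : IsFiniteLimit F G ρ) {θ : ℕ → Set F.W} (hθ : ∀ n, Clopen ρ (θ n))
    (φ : ModalFormula Λ) : Clopen ρ {x | F.Truth θ x φ} := by
  obtain ⟨k, η, hη⟩ := h.exists_level θ φ.finite_vars fun n _ => hθ n
  exact ⟨k, {v | (G k).Truth η v φ}, by
    ext x; exact Frame.truth_boundedMorphism (ρ k) (h.hom k) (h.back k) θ η φ hη x⟩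

/-- Clopen valuations make `F` a general frame: they are closed under definability, and on each
formula they come from some `G k`. Soundness therefore passes to `F` for these valuations, although
`F` itself need not validate `S`. -/
theorem truth_of_mem_normalLogic (h : IsFiniteLimit F G ρ) {S : Set (ModalFormula Λ)}
    (hS : ∀ ψ ∈ S, ∀ k, (G k).Valid ψ) {χ : ModalFormula Λ} (hχ : χ ∈ normalLogic S)
    {θ : ℕ → Set F.W} (hθ : ∀ n, Clopen ρ (θ n)) (x : F.W) : F.Truth θ x χ := by
  refine hχ _ ⟨F.isNormalLogic_of_valuations {θ | ∀ n, Clopen ρ (θ n)}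
    fun θ hθ σ n => h.clopen_truth hθ (σ n), ?_⟩ θ hθ x
  intro ψ hψ θ hθ x
  obtain ⟨k, η, hη⟩ := h.exists_level θ ψ.finite_vars fun n _ => hθ n
  exact (Frame.truth_boundedMorphism (ρ k) (h.hom k) (h.back k) θ η ψ hη x).2 (hS ψ hψ k _ _)

/-- Naming every point of every finite frame by a variable makes the theories of points of `F`
separate them. -/
theorem exists_enumeration (h : IsFiniteLimit F G ρ) :
    ∃ θ : ℕ → Set F.W, (∀ n, Clopen ρ (θ n)) ∧
      ∀ k (v : (G k).W), ∃ n, ∀ x, x ∈ θ n ↔ ρ k x = v := by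
  have := h.finite
  rcases isEmpty_or_nonempty (Σ k, (G k).W) with he | he
  · exact ⟨fun _ => ∅, fun _ => ⟨0, ∅, rfl⟩, fun k v => (he.false ⟨k, v⟩).elim⟩
  · obtain ⟨f, hf⟩ := exists_surjective_nat (Σ k, (G k).W)
    refine ⟨fun n => ρ (f n).1 ⁻¹' {(f n).2}, fun n => ⟨_, _, rfl⟩, fun k v => ?_⟩
    obtain ⟨n, hn⟩ := hf ⟨k, v⟩
    refine ⟨n, fun x => ?_⟩
    show ρ (f n).1 x = (f n).2 ↔ _
    rw [hn]

/-- A canonical formula that is valid in finite frames is valid in their inverse limit. -/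
theorem valid_of_canonical (h : IsFiniteLimit F G ρ) {ψ : ModalFormula Λ} (hψ : Canonical ψ)
    (hG : ∀ k, (G k).Valid ψ) : F.Valid ψ := by
  obtain ⟨θ, hθ, hname⟩ := h.exists_enumeration
  set L := normalLogic {ψ}
  have hL : IsNormalLogic L := isNormalLogic_normalLogic _
  have hsound : ∀ χ ∈ L, ∀ x, F.Truth θ x χ := fun χ hχ x =>
    h.truth_of_mem_normalLogic (by simpa using hG) hχ hθ x
  have hmax : ∀ x : F.W, Maximal (Consistent L) {χ | F.Truth θ x χ} := by
    intro x
    constructor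
    · intro l hl hmem
      exact (F.truth_foldr_imp_bot θ x l).1 (hsound _ hmem x) hl
    · intro Δ hΔ hsub χ hχ
      by_contra hn
      refine hΔ [χ, neg χ] ?_ (hL.taut _ fun e _ h1 => ?_)
      · simpa [hχ] using hsub (show neg χ ∈ _ from hn)
      · simp only [List.foldr_cons, List.foldr_nil, h1]
        tauto
  -- Sending a point to its theory embeds `F` as a generated subframe of the canonical frame, and
  -- validity of `ψ` passes to it.
  let f : F.W → (canonicalFrame L).W := fun x => ⟨_, hmax x⟩
  have hinj : Function.Injective f := by
    intro x y hxy
    refine h.inj x y fun k => ?_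
    obtain ⟨n, hn⟩ := hname k (ρ k x)
    have : ModalFormula.var n ∈ (f y).1 := by
      rw [← hxy]; exact (hn x).2 rfl
    exact ((hn y).1 this).symm
  -- A compactness argument: finite parts of `Δ` are true at successors of `x`, and `Δ` names a
  -- point `v k` of each finite `G k`. These points are the projections of some `y` by `complete`,
  -- and `full` makes `y` a successor of `x`.
  have hback : ∀ l x Δ, (canonicalFrame L).R l (f x) Δ → ∃ y, F.R l x y ∧ f y = Δ := by
    intro l x Δ hR
    have hsat : ∀ Γ : List (ModalFormula Λ), (∀ φ ∈ Γ, φ ∈ Δ.1) →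
        ∃ z, F.R l x z ∧ ∀ φ ∈ Γ, F.Truth θ z φ := by
      intro Γ hΓ
      obtain ⟨z, hz, ht⟩ := hR _ (hL.neg_foldr_mem Δ.2 hΓ)
      refine ⟨z, hz, ?_⟩
      by_contra hc
      exact ht ((F.truth_foldr_imp_bot θ z Γ).2 hc)
    choose N hN using hname
    have hex : ∀ k, ∃ v, ModalFormula.var (N k v) ∈ Δ.1 := by
      intro k
      by_contra hc
      push Not at hc
      have := h.finite k
      have := Fintype.ofFinite (G k).W
      obtain ⟨z, -, hz⟩ := hsat ((Finset.univ.toList).map fun v => neg (var (N k v))) (by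
        intro φ hφ
        obtain ⟨v, -, rfl⟩ := List.mem_map.1 hφ
        exact (hL.mem_or_neg_mem Δ.2 _).resolve_left (hc v))
      exact hz (neg (var (N k (ρ k z)))) (List.mem_map.2 ⟨_, by simp, rfl⟩) ((hN k _ z).2 rfl)
    choose v hv using hex
    have hpt : ∀ (k : ℕ) (χ), χ ∈ Δ.1 →
        ∃ z, F.R l x z ∧ F.Truth θ z χ ∧ ∀ j ≤ k, ρ j z = v j := by
      intro k χ hχ
      obtain ⟨z, hz, ht⟩ := hsat (χ :: (List.range (k + 1)).map fun j => var (N j (v j))) (by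
        intro φ hφ
        rcases List.mem_cons.1 hφ with rfl | hφ
        · exact hχ
        · obtain ⟨j, -, rfl⟩ := List.mem_map.1 hφ
          exact hv j)
      refine ⟨z, hz, ht _ List.mem_cons_self, fun j hj => ?_⟩
      exact (hN j _ z).1 (ht (var (N j (v j))) (List.mem_cons_of_mem _
        (List.mem_map.2 ⟨j, by simpa using Nat.lt_succ_of_le hj, rfl⟩)))
    obtain ⟨y, hy⟩ := h.complete v fun k =>
      let ⟨z, _, _, hz⟩ := hpt k _ (hv k)
      ⟨z, hz⟩
    refine ⟨y, h.full l x y fun k => ?_, ?_⟩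
    · obtain ⟨z, hz, -, hzk⟩ := hpt k _ (hv k)
      rw [hy, ← hzk k le_rfl]
      exact h.hom k l x z hz
    · have hsub : Δ.1 ⊆ (f y).1 := by
        intro χ hχ
        obtain ⟨k, U, hU⟩ := h.clopen_truth hθ χ
        obtain ⟨z, -, hz, hzk⟩ := hpt k χ hχ
        have h1 : z ∈ ρ k ⁻¹' U := hU ▸ hz
        have h2 : y ∈ ρ k ⁻¹' U := by
          rw [Set.mem_preimage, hy, ← hzk k le_rfl]; exact h1
        exact (hU ▸ h2 : y ∈ {x | F.Truth θ x χ})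
      exact Subtype.ext (le_antisymm (Δ.2.2 (f y).2.1 hsub) hsub)
  intro w η
  rw [Frame.truth_boundedMorphism f (fun l x y hxy χ hχ => ⟨y, hxy, hχ⟩) hback η
    (fun n => f '' η n) ψ fun p _ x => (hinj.mem_set_image).symm]
  exact hψ _ _

end IsFiniteLimit

end ModalDiagram

namespace ModalDiagram

open FirstOrder ModalFormula

variable {Λ : Type u}

/-! ### Homomorphisms from diagrams -/

namespace Diagram

variable (D : Diagram Λ)

/-- `f` is a homomorphism from the diagram to the frame `F`. -/
def IsHom (F : Frame Λ) (f : D.W → F.W) : Prop := ∀ l x y, D.R l x y → F.R l (f x) (f y)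

/-- `e(w)` holds in `F`. -/
def HomAt (F : Frame Λ) (w : F.W) : Prop := ∃ f : D.W → F.W, f D.root = w ∧ D.IsHom F f

theorem mem_frameClass {F : Frame Λ} : F ∈ D.frameClass ↔ ∀ w : F.W, D.HomAt F w :=
  D.realize_eSentence F

variable {D}

/-- Minimality is used in this form: a first-order countermodel, read as a Kripke frame. -/
theorem GloballyMinimal.exists_frame (h : D.GloballyMinimal) {x y : D.W} {l : Λ}
    (hxy : D.R l x y) :
    ∃ M : Frame Λ, (∀ m, (D.deleteEdge x l y).HomAt M m) ∧ ∃ m, ¬ D.HomAt M m := by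
  have h' := h x l y hxy
  rw [FirstOrder.Language.Theory.models_sentence_iff] at h'
  push Not at h'
  obtain ⟨M, hM⟩ := h'
  obtain ⟨F, hF⟩ : ∃ F : Frame Λ, ∀ a : (frameLang Λ).Sentence,
      F.W ⊨ a ↔ M ⊨ a := by
    let F : Frame Λ := ⟨M, fun l a b =>
      FirstOrder.Language.Structure.RelMap (L := frameLang Λ) (M := M) (FrameRel.rel l) ![a, b]⟩
    have hs : F.structure = M.struc := by
      ext n f v
      · exact f.elim
      · cases f
        show FirstOrder.Language.Structure.RelMap (L := frameLang Λ) (M := M) (FrameRel.rel _)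
          ![v 0, v 1] ↔ _
        have : ![v 0, v 1] = v := by ext i; fin_cases i <;> rfl
        rw [this]
    refine ⟨F, fun a => ?_⟩
    rw [hs]
  have hM' : ¬ (F ∈ (D.deleteEdge x l y).frameClass → F ∈ D.frameClass) := fun hc =>
    hM fun h₁ => (hF _).1 (hc ((hF _).2 h₁))
  rw [mem_frameClass, mem_frameClass] at hM'
  push Not at hM'
  exact ⟨F, hM'⟩

/-- The distance from the root. -/
theorem Rooted.exists_dist (h : D.Rooted) :
    ∃ d : D.W → ℕ, d D.root = 0 ∧ (∀ l x y, D.R l x y → d y ≤ d x + 1) ∧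
      ∀ x ≠ D.root, ∃ z l, D.R l z x ∧ d x = d z + 1 := by
  -- `P n x` says that a directed walk of length `n` leads from the root to `x`.
  let P : ℕ → D.W → Prop := fun n =>
    Nat.rec (fun x => x = D.root) (fun _ Q x => ∃ z l, Q z ∧ D.R l z x) n
  have hP : ∀ x, ∃ n, P n x := by
    intro x
    induction h x with
    | refl => exact ⟨0, rfl⟩
    | tail _ hbc ih =>
      obtain ⟨n, hn⟩ := ih
      obtain ⟨l, hl⟩ := hbc
      exact ⟨n + 1, _, l, hn, hl⟩
  have hmin : ∀ x, ∃ n, P n x ∧ ∀ m, P m x → n ≤ m := fun x =>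
    ⟨sInf {n | P n x}, Nat.sInf_mem (hP x), fun m hm => Nat.sInf_le hm⟩
  choose d hspec hle using hmin
  have hstep : ∀ l x y, D.R l x y → d y ≤ d x + 1 := fun l x y hxy =>
    hle _ (d x + 1) ⟨x, l, hspec x, hxy⟩
  refine ⟨d, Nat.le_zero.1 (hle _ 0 rfl), hstep, fun x hx => ?_⟩
  have hx' := hspec x
  rcases hn : d x with _ | n
  · rw [hn] at hx'
    exact absurd hx' hx
  · rw [hn] at hx'
    obtain ⟨z, l, hz, hl⟩ := hx'
    refine ⟨z, l, hl, ?_⟩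
    have h1 := hle _ _ hz
    have h2 := hstep l z x hl
    omega

/-! ### Edges on inner cycles -/

variable (D) in
/-- An edge off the root whose end points remain connected by undirected paths off the root when
the edge is deleted. -/
structure IsCycleEdge (e : D.W × Λ × D.W) : Prop where
  edge : D.R e.2.1 e.1 e.2.2
  source_ne : e.1 ≠ D.root
  target_ne : e.2.2 ≠ D.root
  connected : ∀ (I : Type) (j : D.W → I), (∀ a l b, D.R l a b → a ≠ D.root → b ≠ D.root →
    (a, l, b) ≠ e → j a = j b) → j e.1 = j e.2.2

/-- The edge traversed by a step of an undirected path. -/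
def stepEdge (s : Λ × Bool) (x y : D.W) : D.W × Λ × D.W := if s.2 then (x, s.1, y) else (y, s.1, x)

/-- On a shortest cycle off the root no point recurs except at the two ends, so the first edge is
traversed only once and the remaining steps connect its end points. -/
theorem exists_isCycleEdge (h : D.HasInnerCycle) : ∃ e, D.IsCycleEdge e := by
  classical
  let P : ℕ → Prop := fun n => ∃ (z : ℕ → D.W) (s : ℕ → Λ × Bool),
    D.IsUndirectedCycle n z s ∧ ∀ i ≤ n, z i ≠ D.root
  have hP : ∃ n, P n := h
  obtain ⟨z, s, ⟨hpos, hstep, hclosed, hred⟩, hroot⟩ := Nat.find_spec hP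
  have hmin := fun m => Nat.find_min hP (m := m)
  set n := Nat.find hP
  have hdist : ∀ a b, a < b → b ≤ n → z a = z b → a = 0 ∧ b = n := by
    intro a b hab hbn hz
    by_contra hc
    refine hmin (b - a) (by omega) ⟨fun i => z (a + i), fun i => s (a + i),
      ⟨by omega, fun i hi => hstep (a + i) (by omega), ?_, fun i hi => hred (a + i) (by omega)⟩,
      fun i hi => hroot (a + i) (by omega)⟩
    show z (a + (b - a)) = z a
    rw [hz]; congr 1; omega
  have hst : ∀ i < n, D.R (s i).1 (stepEdge (s i) (z i) (z (i + 1))).1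
      (stepEdge (s i) (z i) (z (i + 1))).2.2 := by
    intro i hi
    have := hstep i hi
    rcases hs : s i with ⟨l, _ | _⟩ <;> rw [hs] at this <;> exact this
  have hne : ∀ i, 1 ≤ i → i < n →
      stepEdge (s i) (z i) (z (i + 1)) ≠ stepEdge (s 0) (z 0) (z 1) := by
    intro i h1 hi heq
    have hlab : (s i).1 = (s 0).1 := by
      have := congrArg (fun e => e.2.1) heq
      rcases h : s i with ⟨l, _ | _⟩ <;> rcases h' : s 0 with ⟨l', _ | _⟩ <;>
        simpa [stepEdge, h, h'] using this
    have hcases : (s i).2 = (s 0).2 ∧ z i = z 0 ∨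
        (s i).2 = !(s 0).2 ∧ z i = z 1 ∧ z (i + 1) = z 0 := by
      rcases h : s i with ⟨l, _ | _⟩ <;> rcases h' : s 0 with ⟨l', _ | _⟩ <;>
        simp only [stepEdge, h, h', Prod.mk.injEq, if_true, if_false, Bool.false_eq_true] at heq <;>
        simp [heq]
    -- A second traversal in the same direction repeats `z 0`; one in the opposite direction repeats
    -- `z 1`, unless it is the immediate reversal, which is excluded.
    rcases hcases with ⟨-, h0⟩ | ⟨hb, hz1, hz0⟩
    · have := hdist 0 i h1 hi.le h0.symm
      omega
    · have hi1 : i = 1 := by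
        by_contra hc
        have := hdist 1 i (by omega) hi.le hz1.symm
        omega
      subst hi1
      exact hred 0 (by omega) ⟨hz0, Prod.ext hlab hb⟩
  refine ⟨stepEdge (s 0) (z 0) (z 1), ?_, ?_, ?_, fun I j hj => ?_⟩
  · have := hst 0 hpos
    rcases h' : s 0 with ⟨l', _ | _⟩ <;> rw [h'] at this <;> exact this
  · rcases h' : s 0 with ⟨l', _ | _⟩
    · exact hroot 1 hpos
    · exact hroot 0 (by omega)
  · rcases h' : s 0 with ⟨l', _ | _⟩
    · exact hroot 0 (by omega)
    · exact hroot 1 hpos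
  · have hconst : ∀ i, i + 1 ≤ n → j (z (i + 1)) = j (z 1) := by
      intro i
      induction i with
      | zero => exact fun _ => rfl
      | succ i ih =>
        intro hi
        rw [← ih (by omega)]
        have h1 := hst (i + 1) (by omega)
        have h2 := hne (i + 1) (by omega) (by omega)
        rcases h' : s (i + 1) with ⟨l', _ | _⟩ <;> rw [h'] at h1 h2
        · exact hj _ _ _ h1 (hroot _ hi) (hroot _ (by omega)) h2
        · exact (hj _ _ _ h1 (hroot _ (by omega)) (hroot _ hi) h2).symm
    have := hconst (n - 1) (by omega)
    rw [Nat.sub_add_cancel hpos, hclosed] at this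
    rcases h' : s 0 with ⟨l', _ | _⟩
    · exact this.symm
    · exact this

/-! ### A finite frame in which the diagram sits rigidly -/

variable (D) in
/-- A finite frame that consists of a copy `ι` of the diagram and of further edges `deep`, such that
the diagram maps to the deep edges at every point but the root of the copy, and such that no edge of
the copy can be avoided by homomorphisms at the root. -/
structure Base where
  P : Type u
  finite : Finite P
  deep : Λ → P → P → Prop
  ι : D.W → P
  injective : Function.Injective ι
  attach : ∀ b, b ≠ ι D.root → ∃ h : D.W → P, h D.root = b ∧
    ∀ l x y, D.R l x y → deep l (h x) (h y)
  rigid : ∀ l x y, D.R l x y → ¬ ∃ g : D.W → P, g D.root = ι D.root ∧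
    ∀ m x' y', D.R m x' y' → deep m (g x') (g y') ∨
      ∃ a b, D.R m a b ∧ ¬ (m = l ∧ a = x ∧ b = y) ∧ ι a = g x' ∧ ι b = g y'

variable (D) in
open Classical in
/-- The point `x` of the copy of the diagram attached at `t`. -/
noncomputable def glue (t : List D.W) (x : D.W) : List D.W := if x = D.root then t else x :: t

theorem glue_root (t : List D.W) : D.glue t D.root = t := if_pos rfl

theorem glue_of_ne (t : List D.W) {x : D.W} (h : x ≠ D.root) : D.glue t x = x :: t := if_neg h

theorem sum_map_glue {d : D.W → ℕ} (h0 : d D.root = 0) (t : List D.W) (x : D.W) :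
    ((D.glue t x).map d).sum = (t.map d).sum + d x := by
  by_cases h : x = D.root
  · rw [h, glue_root, h0, add_zero]
  · rw [glue_of_ne _ h, List.map_cons, List.sum_cons, add_comm]

theorem ne_root_of_mem_glue {t : List D.W} (ht : ∀ x ∈ t, x ≠ D.root) (x : D.W) :
    ∀ y ∈ D.glue t x, y ≠ D.root := by
  by_cases h : x = D.root
  · rwa [h, glue_root]
  · rw [glue_of_ne _ h]
    simpa using ⟨h, ht⟩

theorem glue_nil_injective : Function.Injective (D.glue []) := by
  intro x y h
  by_cases hx : x = D.root <;> by_cases hy : y = D.root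
  · rw [hx, hy]
  · rw [hx, glue_root, glue_of_ne _ hy] at h
    cases h
  · rw [hy, glue_root, glue_of_ne _ hx] at h
    cases h
  · rw [glue_of_ne _ hx, glue_of_ne _ hy] at h
    exact (List.cons.inj h).1

variable (D) in
/-- The words of points off the root whose total distance is at most `K`. -/
def IsWord (d : D.W → ℕ) (K : ℕ) (t : List D.W) : Prop :=
  (t.map d).sum ≤ K ∧ ∀ x ∈ t, x ≠ D.root

variable (D) in
/-- The edges of the copies of the diagram attached at nonempty words; the extra point sees
everything, and is seen by the words of maximal total distance. -/
def wordRel (d : D.W → ℕ) (K : ℕ) (l : Λ) :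
    Option {t // D.IsWord d K t} → Option {t // D.IsWord d K t} → Prop
  | some u, some v => ∃ t x y, t ≠ [] ∧ D.R l x y ∧ u.1 = D.glue t x ∧ v.1 = D.glue t y
  | some u, none => K ≤ (u.1.map d).sum
  | none, _ => True

-- Copies of the diagram are attached repeatedly at the points off the root; a word records the
-- attachments, the latest first. Words are cut off at total distance `K`, a bound for all
-- distances, and there are finitely many because each letter contributes at least one. The point
-- `none` absorbs everything beyond.
open Classical in
theorem exists_base (hroot : D.Rooted) (hmin : D.GloballyMinimal) : Nonempty D.Base := by
  obtain ⟨d, h0, hstep, hpred⟩ := hroot.exists_dist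
  have := D.finite_points
  obtain ⟨K, hK⟩ : ∃ K, ∀ x, d x ≤ K := by
    obtain ⟨K, hK⟩ := (Set.finite_range d).bddAbove
    exact ⟨K, fun x => hK ⟨x, rfl⟩⟩
  have hpos : ∀ x, x ≠ D.root → 1 ≤ d x := fun x hx => by
    obtain ⟨z, l, -, hz⟩ := hpred x hx
    omega
  have hlen : ∀ t : List D.W, (∀ x ∈ t, x ≠ D.root) → t.length ≤ (t.map d).sum := by
    intro t
    induction t with
    | nil => simp
    | cons a t ih =>
      intro h
      have := ih fun x hx => h x (List.mem_cons_of_mem _ hx)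
      have := hpos a (h a List.mem_cons_self)
      simp only [List.length_cons, List.map_cons, List.sum_cons]
      omega
  have hfin : Finite {t // D.IsWord d K t} :=
    ((List.finite_length_le D.W K).subset fun t ht => (hlen t ht.2).trans ht.1).to_subtype
  let ι : D.W → Option {t // D.IsWord d K t} := fun x => some ⟨D.glue [] x, by
    rw [sum_map_glue h0]; simpa using hK x, ne_root_of_mem_glue (by simp) x⟩
  refine ⟨⟨_, inferInstance, D.wordRel d K, ι, fun x y h => ?_, ?_, ?_⟩⟩
  · exact glue_nil_injective (congrArg Subtype.val (Option.some.inj h))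
  · rintro (_ | u) hu
    · exact ⟨fun _ => none, rfl, fun _ _ _ _ => trivial⟩
    · have hne : u.1 ≠ [] := fun h => hu (by
        refine congrArg some (Subtype.ext ?_)
        rw [h]; exact (glue_root []).symm)
      have hgood : ∀ x, ((D.glue u.1 x).map d).sum ≤ K → D.IsWord d K (D.glue u.1 x) :=
        fun x hx => ⟨hx, ne_root_of_mem_glue u.2.2 x⟩
      -- Points of the new copy beyond the cutoff go to `none`. Distance rises by at most one along
      -- an edge, so the words are left only from total distance `K`, where `none` is visible.
      refine ⟨fun x => if h : D.IsWord d K (D.glue u.1 x) then some ⟨_, h⟩ else none, ?_, ?_⟩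
      · have : D.IsWord d K (D.glue u.1 D.root) := by rw [glue_root]; exact u.2
        beta_reduce
        rw [dif_pos this]
        exact congrArg some (Subtype.ext (glue_root _))
      · intro l x y hxy
        beta_reduce
        by_cases hx : D.IsWord d K (D.glue u.1 x)
        · by_cases hy : D.IsWord d K (D.glue u.1 y)
          · rw [dif_pos hx, dif_pos hy]
            exact ⟨u.1, x, y, hne, hxy, rfl, rfl⟩
          · rw [dif_pos hx, dif_neg hy]
            have h1 := mt (hgood y) hy
            rw [sum_map_glue h0] at h1
            have h2 := hstep l x y hxy
            show K ≤ ((D.glue u.1 x).map d).sum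
            rw [sum_map_glue h0]
            omega
        · rw [dif_neg hx]
          trivial
  · rintro l x y hxy ⟨g, hg0, hg⟩
    obtain ⟨M, hM, m₀, hm₀⟩ := hmin.exists_frame hxy
    -- With `K + 1` as the weight of `none`, weights rise by at most one along every edge. So `g x`
    -- has weight at most `d x ≤ K` and is never `none`.
    let wt : Option {t // D.IsWord d K t} → ℕ := fun u => u.elim (K + 1) fun t => (t.1.map d).sum
    have hwt : ∀ l u v, D.wordRel d K l u v → wt v ≤ wt u + 1 := by
      rintro l (_ | u) (_ | v) h
      · simp [wt]
      · have := v.2.1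
        simp only [wt, Option.elim]
        omega
      · exact Nat.succ_le_succ h
      · obtain ⟨t, x, y, -, hxy, hu, hv⟩ := h
        have := hstep l x y hxy
        simp only [wt, Option.elim, hu, hv, sum_map_glue h0]
        omega
    have hwι : ∀ x, wt (ι x) = d x := fun x => by
      simp only [wt, ι, Option.elim, sum_map_glue h0]
      simp
    have hwg : ∀ n x, d x = n → wt (g x) ≤ n := by
      intro n
      induction n with
      | zero =>
        intro x hx
        have : x = D.root := by
          by_contra hc
          have := hpos x hc
          omega
        rw [this, hg0, hwι, h0]
      | succ n ih =>
        intro x hx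
        obtain ⟨z, l, hz, hd⟩ := hpred x (by rintro rfl; omega)
        have h1 := ih z (by omega)
        rcases hg l z x hz with h | ⟨a, b, hab, -, ha, hb⟩
        · have := hwt _ _ _ h
          omega
        · rw [← hb, hwι]
          rw [← ha, hwι] at h1
          have := hstep _ _ _ hab
          omega
    -- Words are evaluated in `M` by `ψ`, with a homomorphism `f` of the reduced diagram on the
    -- first copy and the inductively given maps `H` on the attached ones. Since `g` avoids the
    -- deleted edge, `f` suffices on the first copy. A nonempty base word uses up at least one unit
    -- of distance, so `H` is needed only on edges at distance less than `k`. At `k = K + 1` the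
    -- diagram maps to `M` at `m₀`, a contradiction.
    have key : ∀ k : ℕ, ∀ m : M.W, ∃ f : D.W → M.W, f D.root = m ∧
        ∀ l x y, D.R l x y → d x < k → d y < k → M.R l (f x) (f y) := by
      intro k
      induction k with
      | zero => exact fun m => ⟨fun _ => m, rfl, fun _ _ _ _ h => absurd h (Nat.not_lt_zero _)⟩
      | succ k ih =>
        intro m
        choose H H0 HR using ih
        obtain ⟨f, hf0, hf⟩ := hM m
        have hf0 : f D.root = m := hf0
        let ψ : List D.W → M.W := fun t =>
          List.rec m (fun x t r => if t = [] then f x else H r x) t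
        have hψ : ∀ t, t ≠ [] → ∀ x, ψ (D.glue t x) = H (ψ t) x := by
          intro t ht x
          by_cases hx : x = D.root
          · rw [hx, glue_root, H0]
          · rw [glue_of_ne _ hx]
            exact if_neg ht
        have hψ0 : ∀ x, ψ (D.glue [] x) = f x := by
          intro x
          by_cases hx : x = D.root
          · rw [hx, glue_root, hf0]
          · rw [glue_of_ne _ hx]
            exact if_pos rfl
        refine ⟨fun x => (g x).elim m fun t => ψ t.1, ?_, fun l' x' y' hxy' hx' hy' => ?_⟩
        · simp only [hg0, ι, Option.elim, hψ0, hf0]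
        · have h1 := hwg _ x' rfl
          have h2 := hwg _ y' rfl
          have h3 := hK x'
          have h4 := hK y'
          rcases hg l' x' y' hxy' with h | ⟨a, b, hab, hne, ha, hb⟩
          · rcases hgx : g x' with _ | u
            · rw [hgx] at h1
              simp only [wt, Option.elim] at h1
              omega
            rcases hgy : g y' with _ | v
            · rw [hgy] at h2
              simp only [wt, Option.elim] at h2
              omega
            rw [hgx, hgy] at h
            obtain ⟨t, a, b, ht, hab, hu, hv⟩ := h
            have ht1 : 1 ≤ (t.map d).sum := by
              rcases t with _ | ⟨c, t⟩
              · exact absurd rfl ht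
              · have hc : c ≠ D.root := by
                  refine u.2.2 c ?_
                  rw [hu]
                  by_cases ha : a = D.root
                  · rw [ha, glue_root]; exact List.mem_cons_self
                  · rw [glue_of_ne _ ha]; simp
                have := hpos c hc
                simp only [List.map_cons, List.sum_cons]
                omega
            rw [hgx] at h1
            rw [hgy] at h2
            simp only [wt, Option.elim, hu, hv, sum_map_glue h0] at h1 h2
            beta_reduce
            rw [hgx, hgy, Option.elim_some, Option.elim_some, hu, hv, hψ t ht, hψ t ht]
            exact HR _ _ _ _ hab (by omega) (by omega)
          · beta_reduce
            rw [← ha, ← hb]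
            simp only [ι, Option.elim, hψ0]
            exact hf _ _ _ ⟨hab, hne⟩
    obtain ⟨f, hf0, hf⟩ := key (K + 1) m₀
    exact hm₀ ⟨f, hf0, fun l x y hxy =>
      hf l x y hxy (Nat.lt_succ_of_le (hK x)) (Nat.lt_succ_of_le (hK y))⟩

end Diagram

end ModalDiagram

namespace ModalDiagram

open FirstOrder ModalFormula

variable {Λ : Type u}

/-! ### Twisted frames -/

/-- There is no proper colouring of the graph `E` with `m` colours. -/
def NotColourable {I : Type} (E : I → I → Prop) (m : ℕ) : Prop :=
  ∀ c : I → Fin m, ∃ i j, E i j ∧ c i = c j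

theorem NotColourable.mono {I : Type} {E : I → I → Prop} {m n : ℕ} (h : NotColourable E n)
    (hmn : m ≤ n) : NotColourable E m := fun c => by
  obtain ⟨i, j, hij, hc⟩ := h fun i => Fin.castLE hmn (c i)
  exact ⟨i, j, hij, Fin.castLE_injective hmn hc⟩

theorem NotColourable.exists_finite {I : Type} {E : I → I → Prop} {C : Type*} [Finite C]
    (h : NotColourable E (Nat.card C)) (c : I → C) : ∃ i j, E i j ∧ c i = c j := by
  obtain ⟨i, j, hij, hc⟩ := h fun i => Finite.equivFin C (c i)
  exact ⟨i, j, hij, (Finite.equivFin C).injective hc⟩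

namespace Diagram

variable {D : Diagram Λ}

namespace Base

variable (B : D.Base) (e : D.W × Λ × D.W) {I : Type} (E : I → I → Prop)

/-- The base frame with its points indexed by `I`: along edges of the copy of the diagram off the
root, the index remains constant, except that it changes according to `E` along `e`. -/
def twist : Frame Λ where
  W := B.P × I
  R l p q := B.deep l p.1 q.1 ∨ ∃ a b, D.R l a b ∧ B.ι a = p.1 ∧ B.ι b = q.1 ∧
    (a ≠ D.root → b ≠ D.root → ((a, l, b) = e → E p.2 q.2) ∧ ((a, l, b) ≠ e → p.2 = q.2))

variable {B e E}

theorem homAt_twist_of_ne {b : B.P} (hb : b ≠ B.ι D.root) (i : I) :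
    D.HomAt (B.twist e E) (b, i) := by
  obtain ⟨h, h0, hR⟩ := B.attach b hb
  exact ⟨fun x => (h x, i), Prod.ext h0 rfl, fun l x y hxy => Or.inl (hR l x y hxy)⟩

-- All points off the root can take the index `k` of the loop, because edges at the root do not
-- constrain the index.
open Classical in
theorem homAt_twist_of_loop {k : I} (hk : E k k) (p : B.P × I) : D.HomAt (B.twist e E) p := by
  obtain ⟨b, i⟩ := p
  by_cases hb : b = B.ι D.root
  · refine ⟨fun x => (B.ι x, if x = D.root then i else k), Prod.ext hb.symm (if_pos rfl), fun l x y hxy =>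
      Or.inr ⟨x, y, hxy, rfl, rfl, fun hx hy => ?_⟩⟩
    simp [hx, hy, hk]
  · exact homAt_twist_of_ne hb i

theorem twist_mem_frameClass {k : I} (hk : E k k) : B.twist e E ∈ D.frameClass :=
  D.mem_frameClass.2 fun p => homAt_twist_of_loop hk p

/-- In a twisted frame, `e(x₀)` fails at the root unless the graph has a loop. -/
theorem exists_loop_of_homAt (hroot : D.Rooted) (he : D.IsCycleEdge e) {i : I}
    (h : D.HomAt (B.twist e E) (B.ι D.root, i)) : ∃ k, E k k := by
  obtain ⟨g, hg0, hg⟩ := h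
  have := D.finite_points
  -- By rigidity, every edge of the copy is the image of an edge under the first component of `g`,
  -- with the index condition in force.
  have hlift : ∀ l x y, D.R l x y → ∃ x' y', D.R l x' y' ∧ B.ι x = (g x').1 ∧ B.ι y = (g y').1 ∧
      (x ≠ D.root → y ≠ D.root → ((x, l, y) = e → E (g x').2 (g y').2) ∧
        ((x, l, y) ≠ e → (g x').2 = (g y').2)) := by
    intro l x y hxy
    by_contra hc
    refine B.rigid l x y hxy ⟨fun z => (g z).1, congrArg Prod.fst hg0, fun m x' y' hxy' => ?_⟩
    rcases hg m x' y' hxy' with hd | ⟨a, b, hab, ha, hb, ht⟩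
    · exact Or.inl hd
    · refine Or.inr ⟨a, b, hab, ?_, ha, hb⟩
      rintro ⟨rfl, rfl, rfl⟩
      exact hc ⟨x', y', hxy', ha, hb, ht⟩
  have hpt : ∀ a, ∃ a', B.ι a = (g a').1 := by
    intro a
    rcases Relation.ReflTransGen.cases_tail (hroot a) with h | ⟨z, -, l, hl⟩
    · exact ⟨D.root, by rw [hg0, h]⟩
    · obtain ⟨-, y', -, -, hy, -⟩ := hlift l z a hl
      exact ⟨y', hy⟩
  -- Injective on a finite set, `β` is bijective, so the first component of `g` permutes the copy
  -- and each point of the copy carries a single index.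
  choose β hβ using hpt
  have hinj : Function.Injective β := fun a b h => B.injective (by rw [hβ, hβ, h])
  have hsurj := Finite.surjective_of_injective hinj
  have hg1 : ∀ u v, (g u).1 = (g v).1 → u = v := by
    intro u v huv
    obtain ⟨a, rfl⟩ := hsurj u
    obtain ⟨b, rfl⟩ := hsurj v
    rw [← hβ, ← hβ] at huv
    rw [B.injective huv]
  have hj : ∀ l a b, D.R l a b → a ≠ D.root → b ≠ D.root →
      ((a, l, b) = e → E (g (β a)).2 (g (β b)).2) ∧
        ((a, l, b) ≠ e → (g (β a)).2 = (g (β b)).2) := by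
    intro l a b hab ha hb
    obtain ⟨x', y', -, hx, hy, ht⟩ := hlift l a b hab
    rw [hβ] at hx hy
    rw [hg1 _ _ hx, hg1 _ _ hy]
    exact ht ha hb
  have hc := he.connected I (fun a => (g (β a)).2) fun a l b hab ha hb hne =>
    (hj l a b hab ha hb).2 hne
  have hE := (hj _ _ _ he.edge he.source_ne he.target_ne).1 rfl
  refine ⟨_, (?_ : E (g (β e.1)).2 (g (β e.1)).2)⟩
  convert hE using 1

/-- A formula of the logic of the diagram is true in a model on a twisted frame if an edge of the
graph joins indices that are not separated by a set of formulas closed under subformulas. -/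
theorem truth_twist {Φ : Set (ModalFormula Λ)} (hΦ : SubformulaClosed Φ)
    {θ : ℕ → Set (B.P × I)} {φ : ModalFormula Λ} (hφ : φ ∈ Φ) (hL : φ ∈ Log D.frameClass)
    {i j : I} (hij : E i j) (hsame : ∀ ψ ∈ Φ, (B.twist e E).Truth θ (B.ι e.2.2, i) ψ ↔
      (B.twist e E).Truth θ (B.ι e.2.2, j) ψ) (w : B.P × I) : (B.twist e E).Truth θ w φ := by
  -- `E'` adds arrows to targets that `Φ` does not distinguish from old ones at the target of `e`.
  -- Truth of formulas in `Φ` is unaffected, yet `i` acquires a loop, which puts the new frame into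
  -- the class.
  let E' : I → I → Prop := fun i k => ∃ j, E i j ∧ ∀ ψ ∈ Φ,
    (B.twist e E).Truth θ (B.ι e.2.2, k) ψ ↔ (B.twist e E).Truth θ (B.ι e.2.2, j) ψ
  have key : ∀ ψ ∈ Φ, ∀ w : B.P × I,
      (B.twist e E').Truth θ w ψ ↔ (B.twist e E).Truth θ w ψ := by
    intro ψ
    induction ψ with
    | var p => exact fun _ _ => Iff.rfl
    | bot => exact fun _ _ => Iff.rfl
    | imp α β h₁ h₂ =>
      intro h w
      exact imp_congr (h₁ (hΦ.left _ _ h) w) (h₂ (hΦ.right _ _ h) w)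
    | dia l α h₁ =>
      intro h w
      have hα := hΦ.dia _ _ h
      constructor
      · rintro ⟨q, hwq, hq⟩
        have hq' := (h₁ hα q).1 hq
        rcases hwq with hd | ⟨a, b, hab, ha, hb, ht⟩
        · exact ⟨q, Or.inl hd, hq'⟩
        · by_cases hc : a ≠ D.root ∧ b ≠ D.root ∧ (a, l, b) = e
          · obtain ⟨k, hk, hsame⟩ := (ht hc.1 hc.2.1).1 hc.2.2
            have hqb : q = (B.ι e.2.2, q.2) := by rw [← hc.2.2]; exact Prod.ext hb.symm rfl
            rw [hqb, hsame α hα] at hq'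
            refine ⟨_, Or.inr ⟨a, b, hab, ha, ?_, fun _ _ => ⟨fun _ => hk, ?_⟩⟩, hq'⟩
            · rw [← hc.2.2]
            · exact fun hne => absurd hc.2.2 hne
          · refine ⟨q, Or.inr ⟨a, b, hab, ha, hb, fun hx hy => ⟨fun he => ?_, (ht hx hy).2⟩⟩, hq'⟩
            exact absurd ⟨hx, hy, he⟩ hc
      · rintro ⟨q, hwq, hq⟩
        refine ⟨q, ?_, (h₁ hα q).2 hq⟩
        rcases hwq with hd | ⟨a, b, hab, ha, hb, ht⟩
        · exact Or.inl hd
        · exact Or.inr ⟨a, b, hab, ha, hb, fun hx hy =>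
            ⟨fun he => ⟨q.2, (ht hx hy).1 he, fun _ _ => Iff.rfl⟩, (ht hx hy).2⟩⟩
  exact (key φ hφ w).1 (hL _ (twist_mem_frameClass (k := i) ⟨j, hij, hsame⟩) w θ)

variable (B e) in
/-- Each formula of the logic of the diagram is valid in the twisted frames over graphs of large
chromatic number. -/
theorem exists_valid_twist {φ : ModalFormula Λ} (hL : φ ∈ Log D.frameClass) :
    ∃ m : ℕ, ∀ (I : Type) (E : I → I → Prop), NotColourable E m → (B.twist e E).Valid φ := by
  have := φ.finite_subformulas.to_subtype
  refine ⟨Nat.card (Set φ.subformulas), fun I E hE w θ => ?_⟩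
  obtain ⟨i, j, hij, hc⟩ := hE.exists_finite fun i =>
    {ψ : φ.subformulas | (B.twist e E).Truth θ (B.ι e.2.2, i) ψ}
  refine truth_twist (subformulaClosed_subformulas φ) (self_mem_subformulas φ) hL hij
    (fun ψ hψ => ?_) w
  exact Set.ext_iff.1 hc ⟨ψ, hψ⟩

open Classical in
variable (B e) in
/-- All formulas of the logic of the diagram in finitely many variables are valid in the twisted
frame over some finite complete graph. -/
theorem exists_valid_twist_of_vars {V : Set ℕ} (hV : V.Finite) :
    ∃ m : ℕ, ∀ φ ∈ Log D.frameClass, φ.vars ⊆ V →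
      (B.twist e (fun i j : Fin (m + 1) => i ≠ j)).Valid φ := by
  have := hV.to_subtype
  have := B.finite
  refine ⟨Nat.card (Set (B.P × V)), fun φ hL hφ w θ => ?_⟩
  -- There are more indices than valuations of `V` on one layer `P × {i}`, so two layers agree.
  -- Swapping them is an automorphism over a complete graph, hence no formula over `V` separates
  -- them.
  have hnot : ¬ Function.Injective (fun i : Fin (Nat.card (Set (B.P × V)) + 1) =>
      ({x | (x.1, i) ∈ θ x.2} : Set (B.P × V))) := by
    intro hinj
    have := Nat.card_le_card_of_injective _ hinj
    simp at this
  simp only [Function.Injective] at hnot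
  push Not at hnot
  obtain ⟨i, j, hc, hij⟩ := hnot
  refine truth_twist (subformulaClosed_vars_subset V) hφ hL hij (fun ψ hψ => ?_) w
  have hcθ : ∀ b, ∀ p ∈ V, (b, i) ∈ θ p ↔ (b, j) ∈ θ p := fun b p hp =>
    Set.ext_iff.1 hc (b, ⟨p, hp⟩)
  have := Frame.truth_boundedMorphism (F := B.twist e (· ≠ ·)) (G := B.twist e (· ≠ ·))
    (fun x => (x.1, Equiv.swap i j x.2)) ?_ ?_ θ θ ψ ?_ (B.ι e.2.2, i)
  · simpa using this
  · rintro l x y (hd | ⟨a, b, hab, ha, hb, ht⟩)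
    · exact Or.inl hd
    · refine Or.inr ⟨a, b, hab, ha, hb, fun hx hy => ⟨fun he h => ?_, fun hne => ?_⟩⟩
      · exact (ht hx hy).1 he ((Equiv.swap i j).injective h)
      · exact congrArg (Equiv.swap i j) ((ht hx hy).2 hne)
  · intro l x v hxv
    refine ⟨(v.1, Equiv.swap i j v.2), ?_, Prod.ext rfl (Equiv.swap_apply_self i j v.2)⟩
    rcases hxv with hd | ⟨a, b, hab, ha, hb, ht⟩
    · exact Or.inl hd
    · refine Or.inr ⟨a, b, hab, ha, hb, fun hx hy => ⟨fun he h => ?_, fun hne => ?_⟩⟩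
      · exact (ht hx hy).1 he (by
          show Equiv.swap i j x.2 = v.2
          rw [h]; exact Equiv.swap_apply_self i j v.2)
      · have : Equiv.swap i j x.2 = v.2 := (ht hx hy).2 hne
        show x.2 = Equiv.swap i j v.2
        rw [← this, Equiv.swap_apply_self]
  · rintro p hp ⟨b, k⟩
    show (b, k) ∈ θ p ↔ (b, Equiv.swap i j k) ∈ θ p
    by_cases hki : k = i
    · rw [hki, Equiv.swap_apply_left, hcθ b p (hψ hp)]
    · by_cases hkj : k = j
      · rw [hkj, Equiv.swap_apply_right, hcθ b p (hψ hp)]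
      · rw [Equiv.swap_apply_of_ne_of_ne hki hkj]

end Base

/-! ### Formulas of the logic refuted in given frames -/

/-- `y` can be reached from `x` by a path with the given labels. -/
def _root_.ModalDiagram.Frame.Path (F : Frame Λ) : List Λ → F.W → F.W → Prop
  | [], x, y => x = y
  | l :: ω, x, y => ∃ z, F.R l x z ∧ F.Path ω z y

theorem _root_.ModalDiagram.Frame.Path.concat {F : Frame Λ} {ω : List Λ} {x y z : F.W} {l : Λ}
    (h : F.Path ω x y) (hl : F.R l y z) : F.Path (ω ++ [l]) x z := by
  induction ω generalizing x with
  | nil => cases h; exact ⟨z, hl, rfl⟩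
  | cons m ω ih =>
    obtain ⟨v, hv, h⟩ := h
    exact ⟨v, hv, ih h⟩

theorem _root_.ModalDiagram.Frame.truth_foldr_box {F : Frame Λ} (θ : ℕ → Set F.W) (ω : List Λ)
    (φ : ModalFormula Λ) (w : F.W) :
    F.Truth θ w (ω.foldr box φ) ↔ ∀ y, F.Path ω w y → F.Truth θ y φ := by
  induction ω generalizing w with
  | nil => simp [Frame.Path]
  | cons l ω ih =>
    rw [List.foldr_cons, Frame.truth_box]
    simp only [ih, Frame.Path]
    exact ⟨fun h y ⟨z, hz, hy⟩ => h z hz y hy, fun h z hz y hy => h y ⟨z, hz, hy⟩⟩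

theorem IsHom.path {F : Frame Λ} {f : D.W → F.W} (hf : D.IsHom F f) {ω : List Λ} {x y : D.W}
    (h : D.toFrame.Path ω x y) : F.Path ω (f x) (f y) := by
  induction ω generalizing x with
  | nil => exact congrArg f h
  | cons l ω ih =>
    obtain ⟨z, hz, h⟩ := h
    exact ⟨_, hf _ _ _ hz, ih h⟩

/-- If `e(x₀)` fails at a point of a finite frame `Q`, then some formula of the logic of the diagram
fails at all points of frames that are mapped to this point by a homomorphism to `Q`. -/
theorem exists_refuted (hroot : D.Rooted) (Q : Frame Λ) [Finite Q.W] {q : Q.W}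
    (hq : ¬ D.HomAt Q q) : ∃ χ ∈ Log D.frameClass, ∀ (F : Frame Λ) (c : F.W → Q.W),
      (∀ l x y, F.R l x y → Q.R l (c x) (c y)) → ∀ w, c w = q → ¬ F.Valid χ := by
  have := D.finite_points
  have := Fintype.ofFinite Q.W
  obtain ⟨ν, hν⟩ : ∃ ν : Q.W → ℕ, Function.Injective ν :=
    ⟨fun u => Finite.equivFin Q.W u, fun u v h => (Finite.equivFin Q.W).injective (Fin.ext h)⟩
  have hpath : ∀ x, ∃ ω, D.toFrame.Path ω D.root x := by
    intro x
    induction hroot x with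
    | refl => exact ⟨[], rfl⟩
    | tail _ hbc ih =>
      obtain ⟨ω, hω⟩ := ih
      obtain ⟨l, hl⟩ := hbc
      exact ⟨_, hω.concat hl⟩
  choose ω hω using hpath
  let labels : Set Λ := (fun t : D.W × Λ × D.W => t.2.1) '' {t | D.R t.2.1 t.1 t.2.2}
  have : Finite labels := (D.finite_edges.image _).to_subtype
  -- `C` says that a point carries exactly one label `u` from `Q`, and that its successors have
  -- labels allowed by `Q`. Only the modalities on edges of the diagram are used, so `C` is finite
  -- even if `Λ` is not.
  let C : Set (ModalFormula Λ) :=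
    {((Finset.univ : Finset Q.W).toList.map fun u => neg (var (ν u))).foldr imp bot} ∪
    ((fun p : Q.W × Q.W => imp (var (ν p.1)) (neg (var (ν p.2)))) '' {p | p.1 ≠ p.2} ∪
    (fun p : Q.W × labels × Q.W => imp (var (ν p.1)) (box p.2.1.1 (neg (var (ν p.2.2))))) ''
      {p | ¬ Q.R p.2.1.1 p.1 p.2.2})
  have hC : C.Finite := (Set.finite_singleton _).union
    (((Set.toFinite _).image _).union ((Set.toFinite _).image _))
  -- Imposing `C` along one path to each point of the diagram enforces it at all points of any
  -- homomorphic image at `g`. The labels then give a homomorphism to `Q` at `q`.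
  let Γ : Set (ModalFormula Λ) :=
    insert (var (ν q)) (Set.image2 (fun x φ => (ω x).foldr box φ) Set.univ C)
  have hΓ : Γ.Finite := (Set.finite_univ.image2 _ hC).insert _
  refine ⟨hΓ.toFinset.toList.foldr imp bot, fun G hG g θ => ?_, fun F c hc w hw hval => ?_⟩
  · rw [Frame.truth_foldr_imp_bot]
    intro hall
    replace hall : ∀ φ ∈ Γ, G.Truth θ g φ := by simpa using hall
    obtain ⟨f, hf0, hf⟩ := D.mem_frameClass.1 hG g
    have hCx : ∀ x, ∀ φ ∈ C, G.Truth θ (f x) φ := by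
      intro x φ hφ
      refine (Frame.truth_foldr_box θ (ω x) φ g).1
        (hall _ (Or.inr ⟨x, trivial, φ, hφ, rfl⟩)) _ ?_
      rw [← hf0]
      exact hf.path (hω x)
    have hex : ∀ x, ∃ u, f x ∈ θ (ν u) := by
      intro x
      by_contra hne
      push Not at hne
      refine (Frame.truth_foldr_imp_bot θ (f x) _).1 (hCx x _ (Or.inl rfl)) ?_
      intro φ hφ
      obtain ⟨u, -, rfl⟩ := List.mem_map.1 hφ
      exact hne u
    choose n hn using hex
    refine hq ⟨n, ?_, fun l x y hxy => ?_⟩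
    · by_contra hne
      exact hCx D.root _ (Or.inr (Or.inl ⟨(n D.root, q), hne, rfl⟩)) (hn D.root)
        (by rw [hf0]; exact hall _ (Or.inl rfl))
    · by_contra hne
      have h := hCx x _ (Or.inr (Or.inr ⟨(n x, ⟨l, (x, l, y), hxy, rfl⟩, n y), hne, rfl⟩)) (hn x)
      exact (Frame.truth_box θ _ _ _).1 h (f y) (hf l x y hxy) (hn y)
  · let θ : ℕ → Set F.W := fun k => {x | ν (c x) = k}
    refine (Frame.truth_foldr_imp_bot θ w _).1 (hval w θ) ?_
    intro φ hφ
    replace hφ : φ ∈ Γ := by simpa using hφ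
    rcases hφ with rfl | ⟨x, -, φ, hφ, rfl⟩
    · exact congrArg ν hw
    · refine (Frame.truth_foldr_box θ (ω x) φ w).2 fun y _ => ?_
      rcases hφ with rfl | ⟨⟨u, v⟩, huv, rfl⟩ | ⟨⟨u, l, v⟩, huv, rfl⟩
      · rw [Frame.truth_foldr_imp_bot]
        intro hall
        exact hall (neg (var (ν (c y)))) (List.mem_map.2 ⟨c y, by simp, rfl⟩) rfl
      · intro (h1 : ν (c y) = ν u) (h2 : ν (c y) = ν v)
        exact huv (hν (h1.symm.trans h2))
      · intro (h1 : ν (c y) = ν u)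
        refine (Frame.truth_box θ _ _ _).2 fun z hz (h2 : ν (c z) = ν v) => huv ?_
        rw [← hν h1, ← hν h2]
        exact hc _ _ _ hz

namespace Base

variable {B : D.Base} {e : D.W × Λ × D.W}

variable (B) in
/-- There is a formula of the logic of the diagram refuted in all twisted frames over (nonempty)
`s`-colourable graphs. -/
theorem exists_refuted_twist (hroot : D.Rooted) (he : D.IsCycleEdge e) (s : ℕ) (hs : 0 < s) :
    ∃ χ ∈ Log D.frameClass, ∀ (I : Type) (E : I → I → Prop), Nonempty I → ∀ c : I → Fin s,
      (∀ i j, E i j → c i ≠ c j) → ¬ (B.twist e E).Valid χ := by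
  have := B.finite
  have : Finite (B.twist e (fun i j : Fin s => i ≠ j)).W := inferInstanceAs (Finite (B.P × Fin s))
  have hno : ∀ k, ¬ D.HomAt (B.twist e (fun i j : Fin s => i ≠ j)) (B.ι D.root, k) := by
    intro k h
    obtain ⟨k, hk⟩ := exists_loop_of_homAt hroot he h
    exact hk rfl
  obtain ⟨χ, hL, hχ⟩ := exists_refuted hroot _ (hno ⟨0, hs⟩)
  refine ⟨χ, hL, fun I E ⟨i⟩ c hc => ?_⟩
  -- `χ` was built for the root with index `0`, so the colours are permuted to give `i` that colour.
  let σ := Equiv.swap (c i) ⟨0, hs⟩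
  refine hχ (B.twist e E) (fun p => (p.1, σ (c p.2))) ?_ (B.ι D.root, i)
    (Prod.ext rfl (Equiv.swap_apply_left _ _))
  rintro l x y (hd | ⟨a, b, hab, ha, hb, ht⟩)
  · exact Or.inl hd
  · refine Or.inr ⟨a, b, hab, ha, hb, fun hx hy => ⟨fun he h => ?_, fun hne => ?_⟩⟩
    · exact hc _ _ ((ht hx hy).1 he) (σ.injective h)
    · exact congrArg (fun i => σ (c i)) ((ht hx hy).2 hne)

end Base

end Diagram

end ModalDiagram

namespace ModalDiagram

/-! ### Finite graphs of large chromatic number and large odd girth -/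

/-- Among colourings of a power of `A` by fewer than `|A|` colours, some colour contains pairs that
differ in exactly one prescribed coordinate, for all coordinates. -/
theorem exists_colour_differ {X A C : Type*} [Finite X] [Finite A] [Finite C]
    (hAC : Nat.card C < Nat.card A) (κ : (X → A) → C) :
    ∃ c, ∀ e, ∃ i j, κ i = c ∧ κ j = c ∧ i e ≠ j e ∧ ∀ e' ≠ e, i e' = j e' := by
  classical
  by_contra hc
  push Not at hc
  choose ε hε using hc
  have hA : Nonempty A := by
    by_contra h
    rw [not_nonempty_iff] at h
    simp at hAC
  -- If each colour has a bad coordinate `ε`, the colour of `i` and its values off `ε` determine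
  -- `i`. Overwriting that coordinate by `a` thus loses nothing, and counting gives `|A| ≤ |C|`.
  let Ψ : (X → A) × A → C × (X → A) := fun p => (κ p.1, Function.update p.1 (ε (κ p.1)) p.2)
  have hΨ : Function.Injective Ψ := by
    rintro ⟨i, a⟩ ⟨j, b⟩ h
    have h1 : κ i = κ j := congrArg Prod.fst h
    have h2 : Function.update i (ε (κ i)) a = Function.update j (ε (κ j)) b := congrArg Prod.snd h
    rw [h1] at h2
    have hab : a = b := by simpa using congrFun h2 (ε (κ j))
    have hoff : ∀ e' ≠ ε (κ j), i e' = j e' := fun e' he' => by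
      simpa [he'] using congrFun h2 e'
    have hon : i (ε (κ j)) = j (ε (κ j)) := by
      by_contra hne
      obtain ⟨e', he', hne'⟩ := hε (κ j) i j h1 rfl hne
      exact hne' (hoff e' he')
    refine Prod.ext (funext fun e' => ?_) hab
    by_cases he' : e' = ε (κ j)
    · rw [he']; exact hon
    · exact hoff e' he'
  have := Nat.card_le_card_of_injective Ψ hΨ
  rw [Nat.card_prod, Nat.card_prod, mul_comm] at this
  exact absurd (Nat.le_of_mul_le_mul_right this Nat.card_pos) (not_le.2 hAC)

section Step

variable {V : Type} (A : V → V → Prop) (N : ℕ)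

/-- The graph on `V × (Sym2 V → Fin N)` in which the second component changes in exactly the
coordinate given by the edge that is traversed in the first component. -/
def StepAdj (p q : V × (Sym2 V → Fin N)) : Prop :=
  A p.1 q.1 ∧ p.2 s(p.1, q.1) ≠ q.2 s(p.1, q.1) ∧ ∀ e ≠ s(p.1, q.1), p.2 e = q.2 e

variable {A N}

theorem StepAdj.symm (hA : ∀ u v, A u v → A v u) {p q : V × (Sym2 V → Fin N)}
    (h : StepAdj A N p q) : StepAdj A N q p := by
  obtain ⟨h1, h2, h3⟩ := h
  refine ⟨hA _ _ h1, ?_, ?_⟩ <;> rw [Sym2.eq_swap]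
  · exact h2.symm
  · exact fun e he => (h3 e he).symm

open Classical in
theorem StepAdj.back (hN : 2 ≤ N) (p : V × (Sym2 V → Fin N)) {u : V} (h : A p.1 u) :
    ∃ q, StepAdj A N p q ∧ q.1 = u := by
  have : Nontrivial (Fin N) := Fin.nontrivial_iff_two_le.2 hN
  obtain ⟨a, ha⟩ := exists_ne (p.2 s(p.1, u))
  refine ⟨(u, Function.update p.2 s(p.1, u) a), ⟨h, ?_, fun e he => ?_⟩, rfl⟩
  · simpa using ha.symm
  · exact (Function.update_of_ne he _ _).symm

/-- Each second component `i` induces a colouring of `V`, and these colourings serve as colours in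
`exists_colour_differ`. The resulting `κ` has a monochromatic edge, which lifts because `κ` is
induced by two components differing exactly at that edge. -/
theorem NotColourable.stepAdj [Finite V] {m : ℕ} (h : NotColourable A m)
    (hN : Nat.card (V → Fin m) < N) : NotColourable (StepAdj A N) m := by
  intro c
  obtain ⟨κ, hκ⟩ := exists_colour_differ (X := Sym2 V) (A := Fin N) (by simpa using hN)
    (fun i v => c (v, i))
  obtain ⟨u, v, huv, hc⟩ := h κ
  obtain ⟨i, j, hi, hj, hne, heq⟩ := hκ s(u, v)
  refine ⟨(u, i), (v, j), ⟨huv, hne, heq⟩, ?_⟩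
  have h1 : c (u, i) = κ u := congrFun hi u
  have h2 : c (v, j) = κ v := congrFun hj v
  rw [h1, h2, hc]

variable (A) in
/-- There are no odd closed walks of length at most `n`. -/
def NoOddWalk (n : ℕ) : Prop :=
  ∀ l ≤ n, Odd l → ∀ z : ℕ → V, z l = z 0 → ¬ ∀ i < l, A (z i) (z (i + 1))

theorem NoOddWalk.segment {n : ℕ} (h : NoOddWalk A n) {z : ℕ → V} {l : ℕ}
    (hz : ∀ i < l, A (z i) (z (i + 1))) {a b : ℕ} (hab : a ≤ b) (hb : b ≤ l) (hn : b - a ≤ n)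
    (hodd : Odd (b - a)) : z a ≠ z b := fun heq => by
  refine h (b - a) hn hodd (fun i => z (a + i)) ?_ fun i hi => hz (a + i) (by omega)
  show z (a + (b - a)) = z a
  rw [heq, Nat.add_sub_cancel' hab]

/-- On a closed walk the coordinate changed by the first step must change again, so the first edge
is traversed again. This cuts out of the projection two closed walks of total length `l` or `l - 2`.
If `l` is odd, one of them is odd, and it is shorter than `l`. -/
theorem NoOddWalk.stepAdj {n : ℕ} (h : NoOddWalk A n) : NoOddWalk (StepAdj A N) (n + 1) := by
  intro l hl hodd z hclosed hz
  have hzA : ∀ i < l, A (z i).1 (z (i + 1)).1 := fun i hi => (hz i hi).1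
  have hpos : 0 < l := hodd.pos
  have hne : ∀ i, 1 ≤ i → i < l → s((z 0).1, (z 1).1) ≠ s((z i).1, (z (i + 1)).1) := by
    intro i h1 hi heq
    have hpar : ∀ a b : ℕ, a + b = l ∨ a + b + 2 = l → Odd a ∨ Odd b := by
      intro a b hab
      rw [Nat.odd_iff] at hodd ⊢
      rw [Nat.odd_iff]
      omega
    rcases Sym2.eq_iff.1 heq with ⟨h0, -⟩ | ⟨h0, h1'⟩
    · rcases hpar (i - 0) (l - i) (by omega) with ho | ho
      · exact h.segment (z := fun i => (z i).1) hzA (Nat.zero_le i) hi.le (by omega) ho h0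
      · refine h.segment (z := fun i => (z i).1) hzA hi.le le_rfl (by omega) ho ?_
        show (z i).1 = (z l).1
        rw [hclosed, h0]
    · rcases hpar (i - 1) (l - (i + 1)) (by omega) with ho | ho
      · exact h.segment (z := fun i => (z i).1) hzA h1 hi.le (by omega) ho h1'
      · refine h.segment (z := fun i => (z i).1) hzA hi le_rfl (by omega) ho ?_
        show (z (i + 1)).1 = (z l).1
        rw [hclosed, h0]
  have hconst : ∀ i, i + 1 ≤ l → (z (i + 1)).2 s((z 0).1, (z 1).1) =
      (z 1).2 s((z 0).1, (z 1).1) := by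
    intro i
    induction i with
    | zero => exact fun _ => rfl
    | succ i ih =>
      intro hi
      rw [← ih (by omega)]
      exact ((hz (i + 1) (by omega)).2.2 _ (hne (i + 1) (by omega) (by omega))).symm
  have := hconst (l - 1) (by omega)
  rw [Nat.sub_add_cancel hpos, hclosed] at this
  exact (hz 0 hpos).2.1 this

end Step

/-- A finite graph that is not `m`-colourable. -/
structure HardGraph (m : ℕ) where
  V : Type
  finite : Finite V
  Adj : V → V → Prop
  symm : ∀ u v, Adj u v → Adj v u
  hard : NotColourable Adj m

/-- The tower of graphs obtained from a complete graph by iterating the step construction. -/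
noncomputable def hardGraph (m : ℕ) : ℕ → HardGraph m
  | 0 => ⟨Fin (m + 1), inferInstance, fun i j => i ≠ j, fun _ _ h => h.symm, fun c => by
      have : ¬ Function.Injective c := fun h => by
        simpa using Nat.card_le_card_of_injective c h
      simp only [Function.Injective] at this
      push Not at this
      obtain ⟨i, j, h1, h2⟩ := this
      exact ⟨i, j, h2, h1⟩⟩
  | k + 1 =>
    haveI := (hardGraph m k).finite
    -- The summand `2` exceeds the number of colourings and also ensures at least two values, as
    -- needed for `StepAdj.back`.
    ⟨(hardGraph m k).V × (Sym2 (hardGraph m k).V → Fin (Nat.card ((hardGraph m k).V → Fin m) + 2)),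
      inferInstance, StepAdj (hardGraph m k).Adj _, fun _ _ => StepAdj.symm (hardGraph m k).symm,
      (hardGraph m k).hard.stepAdj (by omega)⟩

/-- A tower of finite graphs, with bounded morphisms between them. -/
structure IsGraphTower (V : ℕ → Type) (A : ∀ k, V k → V k → Prop) (π : ∀ k, V (k + 1) → V k) :
    Prop where
  finite : ∀ k, Finite (V k)
  symm : ∀ k u v, A k u v → A k v u
  hom : ∀ k u v, A (k + 1) u v → A k (π k u) (π k v)
  back : ∀ k u v, A k (π k u) v → ∃ w, A (k + 1) u w ∧ π k w = v
  surj : ∀ k, Function.Surjective (π k)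

theorem exists_graphTower (m : ℕ) : ∃ (V : ℕ → Type) (A : ∀ k, V k → V k → Prop)
    (π : ∀ k, V (k + 1) → V k), IsGraphTower V A π ∧ (∀ k, NotColourable (A k) m) ∧
      ∀ k, NoOddWalk (A k) (k + 1) := by
  refine ⟨fun k => (hardGraph m k).V, fun k => (hardGraph m k).Adj, fun k p => p.1,
    ⟨fun k => (hardGraph m k).finite, fun k => (hardGraph m k).symm, fun k u v h => h.1,
      fun k u v h => StepAdj.back (by omega) u h, fun k v => ⟨(v, fun _ => 0), rfl⟩⟩,
    fun k => (hardGraph m k).hard, fun k => ?_⟩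
  induction k with
  | zero =>
    intro l hl hodd z hz h
    obtain rfl : l = 1 := by have := hodd.pos; omega
    exact h 0 one_pos hz.symm
  | succ k ih => exact ih.stepAdj

namespace IsGraphTower

variable {V : ℕ → Type} {A : ∀ k, V k → V k → Prop} {π : ∀ k, V (k + 1) → V k}

/-- The points of the inverse limit. -/
def Limit (π : ∀ k, V (k + 1) → V k) : Type := {x : ∀ k, V k // ∀ k, π k (x (k + 1)) = x k}

/-- The edges of the inverse limit. -/
def LimitAdj (A : ∀ k, V k → V k → Prop) (x y : Limit π) : Prop := ∀ k, A k (x.1 k) (y.1 k)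

-- For the induction, the section at level `k` is altered to send `π k v` to `v`; a thread through
-- `π k v` following it then passes through `v`.
open Classical in
theorem exists_thread (k : ℕ) : ∀ (v : V k) (up : ∀ j, V j → V (j + 1)),
    (∀ j u, π j (up j u) = u) →
    ∃ x : Limit π, x.1 k = v ∧ ∀ j ≥ k, x.1 (j + 1) = up j (x.1 j) := by
  induction k with
  | zero =>
    intro v up hup
    exact ⟨⟨fun k => Nat.rec v (fun j u => up j u) k, fun k => hup _ _⟩, rfl, fun _ _ => rfl⟩
  | succ k ih =>
    intro v up hup
    obtain ⟨x, hx, hup'⟩ := ih (π k v) (Function.update up k fun u =>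
      if u = π k v then v else up k u) (fun j u => by
        by_cases hj : j = k
        · subst hj
          rw [Function.update_self]
          split_ifs with hu
          · exact hu.symm
          · exact hup _ _
        · rw [Function.update_of_ne hj, hup])
    refine ⟨x, ?_, fun j hj => ?_⟩
    · rw [hup' k le_rfl, Function.update_self, if_pos hx]
    · rw [hup' j (by omega), Function.update_of_ne (by omega)]

theorem limit_surj (h : IsGraphTower V A π) (k : ℕ) (v : V k) : ∃ x : Limit π, x.1 k = v := by
  choose up hup using h.surj
  obtain ⟨x, hx, -⟩ := exists_thread (π := π) k v up hup
  exact ⟨x, hx⟩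

-- Sections are chosen to lift neighbours of `x` to neighbours of `x`. Following them keeps
-- adjacency above level `k`; below it, projections preserve adjacency.
open Classical in
theorem limit_back (h : IsGraphTower V A π) (k : ℕ) (x : Limit π) {v : V k}
    (hv : A k (x.1 k) v) : ∃ y : Limit π, LimitAdj A x y ∧ y.1 k = v := by
  have hup : ∀ j u, ∃ w, π j w = u ∧ (A j (x.1 j) u → A (j + 1) (x.1 (j + 1)) w) := by
    intro j u
    by_cases hu : A j (x.1 j) u
    · obtain ⟨w, hw, hπ⟩ := h.back j (x.1 (j + 1)) u (by rwa [x.2])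
      exact ⟨w, hπ, fun _ => hw⟩
    · obtain ⟨w, hw⟩ := h.surj j u
      exact ⟨w, hw, fun hc => absurd hc hu⟩
  choose up hπ hadj using hup
  obtain ⟨y, hy, hyup⟩ := exists_thread (π := π) k v up hπ
  refine ⟨y, fun j => ?_, hy⟩
  have hge : ∀ j ≥ k, A j (x.1 j) (y.1 j) := by
    intro j hj
    induction j, hj using Nat.le_induction with
    | base => rwa [hy]
    | succ j hj ih =>
      rw [hyup j hj]
      exact hadj j _ ih
  have hdown : ∀ d j, j + d ≥ k → A j (x.1 j) (y.1 j) := by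
    intro d
    induction d with
    | zero => exact fun j hj => hge j hj
    | succ d ih =>
      intro j hj
      have := h.hom j _ _ (ih (j + 1) (by omega))
      rwa [x.2, y.2] at this
  exact hdown k j (by omega)

/-- The limit of a tower of graphs of increasing odd girth is bipartite. -/
theorem exists_limit_colouring (h : IsGraphTower V A π) (hodd : ∀ k, NoOddWalk (A k) (k + 1)) :
    ∃ c : Limit π → Fin 2, ∀ x y, LimitAdj A x y → c x ≠ c y := by
  let S : SimpleGraph (Limit π) :=
    { Adj := LimitAdj A
      symm := ⟨fun x y hxy k => h.symm k _ _ (hxy k)⟩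
      loopless := ⟨fun x hx => hodd 0 1 le_rfl odd_one (fun _ => x.1 0) rfl fun _ _ => hx 0⟩ }
  have : S.Colorable 2 := by
    rw [SimpleGraph.two_colorable_iff_forall_loop_even]
    intro x w
    rw [← Nat.not_odd_iff_even]
    intro ho
    -- An odd closed walk in the limit projects to the level equal to its length, where it is
    -- already excluded.
    refine hodd w.length w.length (Nat.le_succ _) ho (fun i => (w.getVert i).1 w.length) ?_
      fun i hi => w.adj_getVert_succ hi w.length
    simp
  obtain ⟨c⟩ := this
  exact ⟨c, fun x y hxy => c.valid hxy⟩

end IsGraphTower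

/-- `(I, E)` is the inverse limit of finite graphs along surjective bounded morphisms, with
projections `ρ k`. -/
structure IsGraphLimit {I : Type} (E : I → I → Prop) {V : ℕ → Type} (A : ∀ k, V k → V k → Prop)
    (ρ : ∀ k, I → V k) : Prop where
  finite : ∀ k, Finite (V k)
  hom : ∀ k x y, E x y → A k (ρ k x) (ρ k y)
  back : ∀ k x v, A k (ρ k x) v → ∃ y, E x y ∧ ρ k y = v
  surj : ∀ k v, ∃ y, ρ k y = v
  factor : ∀ k, ∃ π : V (k + 1) → V k, ∀ x, ρ k x = π (ρ (k + 1) x)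
  complete : ∀ v : ∀ k, V k, (∀ k, ∃ z, ∀ j ≤ k, ρ j z = v j) → ∃ y, ∀ k, ρ k y = v k
  inj : ∀ x y, (∀ k, ρ k x = ρ k y) → x = y
  full : ∀ x y, (∀ k, A k (ρ k x) (ρ k y)) → E x y

open IsGraphTower in
theorem IsGraphTower.isGraphLimit_sum {V : ℕ → Type} {A : ∀ k, V k → V k → Prop}
    {π : ∀ k, V (k + 1) → V k} (h : IsGraphTower V A π) {J : Type} [Finite J] (K : J → J → Prop) :
    IsGraphLimit (I := Limit π ⊕ J) (Sum.LiftRel (LimitAdj A) K)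
      (V := fun k => V k ⊕ J) (fun k => Sum.LiftRel (A k) K)
      (fun k => Sum.map (fun x => x.1 k) id) where
  finite k := by have := h.finite k; infer_instance
  hom := by
    rintro k _ _ (⟨hxy⟩ | ⟨hxy⟩)
    · exact Sum.LiftRel.inl (hxy k)
    · exact Sum.LiftRel.inr hxy
  back := by
    rintro k (x | a) (v | b) hv
    · obtain ⟨y, hy, hyk⟩ := h.limit_back k x (Sum.liftRel_inl_inl.1 hv)
      exact ⟨Sum.inl y, Sum.LiftRel.inl hy, congrArg Sum.inl hyk⟩
    · cases hv
    · cases hv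
    · exact ⟨Sum.inr b, Sum.LiftRel.inr (Sum.liftRel_inr_inr.1 hv), rfl⟩
  surj := by
    rintro k (v | b)
    · obtain ⟨y, hy⟩ := h.limit_surj k v
      exact ⟨Sum.inl y, congrArg Sum.inl hy⟩
    · exact ⟨Sum.inr b, rfl⟩
  factor k := ⟨Sum.map (π k) id, by
    rintro (x | a)
    · exact congrArg Sum.inl (x.2 k).symm
    · rfl⟩
  complete v hv := by
    rcases h0 : v 0 with v₀ | b
    · have hu : ∀ k, ∃ u, v k = Sum.inl u := by
        intro k
        obtain ⟨z | a, hz⟩ := hv k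
        · exact ⟨_, (hz k le_rfl).symm⟩
        · have := hz 0 (Nat.zero_le _)
          rw [h0] at this
          cases this
      choose u hu using hu
      refine ⟨Sum.inl ⟨u, fun k => ?_⟩, fun k => (hu k).symm⟩
      obtain ⟨z | a, hz⟩ := hv (k + 1)
      · have h1 := hz k (Nat.le_succ k)
        have h2 := hz (k + 1) le_rfl
        rw [hu] at h1 h2
        rw [← Sum.inl.inj h1, ← Sum.inl.inj h2, z.2]
      · have := hz 0 (Nat.zero_le _)
        rw [h0] at this
        cases this
    · refine ⟨Sum.inr b, fun k => ?_⟩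
      obtain ⟨z | a, hz⟩ := hv k
      · have := hz 0 (Nat.zero_le _)
        rw [h0] at this
        cases this
      · have := hz 0 (Nat.zero_le _)
        rw [h0] at this
        rw [← hz k le_rfl]
        cases this
        rfl
  inj := by
    rintro (x | a) (y | b) hxy
    · exact congrArg Sum.inl (Subtype.ext (funext fun k => Sum.inl.inj (hxy k)))
    · cases hxy 0
    · cases hxy 0
    · cases hxy 0
      rfl
  full := by
    rintro (x | a) (y | b) hxy
    · exact Sum.LiftRel.inl fun k => Sum.liftRel_inl_inl.1 (hxy k)
    · cases hxy 0
    · cases hxy 0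
    · exact Sum.LiftRel.inr (Sum.liftRel_inr_inr.1 (hxy 0))

variable {Λ : Type u} {D : Diagram Λ}

/-- Twisting commutes with inverse limits. -/
theorem IsGraphLimit.twist (B : D.Base) (e : D.W × Λ × D.W) {I : Type} {E : I → I → Prop}
    {V : ℕ → Type} {A : ∀ k, V k → V k → Prop} {ρ : ∀ k, I → V k} (h : IsGraphLimit E A ρ) :
    IsFiniteLimit (B.twist e E) (fun k => B.twist e (A k)) (fun k p => (p.1, ρ k p.2)) where
  finite k := by
    have := B.finite
    have := h.finite k
    exact inferInstanceAs (Finite (B.P × V k))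
  hom := by
    rintro k l x y (hd | ⟨a, b, hab, ha, hb, ht⟩)
    · exact Or.inl hd
    · exact Or.inr ⟨a, b, hab, ha, hb, fun hx hy =>
        ⟨fun he => h.hom k _ _ ((ht hx hy).1 he), fun hne => congrArg (ρ k) ((ht hx hy).2 hne)⟩⟩
  back := by
    rintro k l ⟨b, i⟩ ⟨b', v⟩ (hd | ⟨x, y, hxy, hx, hy, ht⟩)
    · obtain ⟨j, rfl⟩ := h.surj k v
      exact ⟨(b', j), Or.inl hd, rfl⟩
    · by_cases hr : x ≠ D.root ∧ y ≠ D.root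
      · by_cases he : (x, l, y) = e
        · obtain ⟨j, hj, rfl⟩ := h.back k i v ((ht hr.1 hr.2).1 he)
          exact ⟨(b', j), Or.inr ⟨x, y, hxy, hx, hy, fun _ _ =>
            ⟨fun _ => hj, fun hne => absurd he hne⟩⟩, rfl⟩
        · have hv : ρ k i = v := (ht hr.1 hr.2).2 he
          exact ⟨(b', i), Or.inr ⟨x, y, hxy, hx, hy, fun _ _ =>
            ⟨fun hc => absurd hc he, fun _ => rfl⟩⟩, Prod.ext rfl hv⟩
      · obtain ⟨j, rfl⟩ := h.surj k v
        exact ⟨(b', j), Or.inr ⟨x, y, hxy, hx, hy, fun h1 h2 => absurd ⟨h1, h2⟩ hr⟩, rfl⟩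
  factor k := by
    obtain ⟨π, hπ⟩ := h.factor k
    exact ⟨fun p => (p.1, π p.2), fun x => Prod.ext rfl (hπ x.2)⟩
  complete v hv := by
    obtain ⟨i, hi⟩ := h.complete (fun k => (v k).2) fun k => by
      obtain ⟨z, hz⟩ := hv k
      exact ⟨z.2, fun j hj => congrArg Prod.snd (hz j hj)⟩
    refine ⟨((v 0).1, i), fun k => Prod.ext ?_ (hi k)⟩
    obtain ⟨z, hz⟩ := hv k
    have h0 : z.1 = (v 0).1 := congrArg Prod.fst (hz 0 (Nat.zero_le k))
    have hk : z.1 = (v k).1 := congrArg Prod.fst (hz k le_rfl)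
    exact h0.symm.trans hk
  inj x y hxy := by
    have h0 : (x.1, ρ 0 x.2) = (y.1, ρ 0 y.2) := hxy 0
    exact Prod.ext (Prod.mk.inj h0).1 (h.inj _ _ fun k => congrArg Prod.snd (hxy k))
  full l x y hxy := by
    by_cases hd : B.deep l x.1 y.1
    · exact Or.inl hd
    -- By injectivity of `B.ι`, the copy edge found at level `0` is the same at all levels.
    · obtain ⟨a, b, hab, ha, hb, -⟩ := (hxy 0).resolve_left hd
      have hall : ∀ k, a ≠ D.root → b ≠ D.root → ((a, l, b) = e → A k (ρ k x.2) (ρ k y.2)) ∧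
          ((a, l, b) ≠ e → ρ k x.2 = ρ k y.2) := by
        intro k
        obtain ⟨a', b', -, ha', hb', ht⟩ := (hxy k).resolve_left hd
        cases B.injective (ha.trans ha'.symm)
        cases B.injective (hb.trans hb'.symm)
        exact ht
      exact Or.inr ⟨a, b, hab, ha, hb, fun hx hy =>
        ⟨fun he => h.full _ _ fun k => (hall k hx hy).1 he,
          fun hne => h.inj _ _ fun k => (hall k hx hy).2 hne⟩⟩

end ModalDiagram

namespace ModalDiagram

open FirstOrder ModalFormula

variable {Λ : Type u}

/-! ### First-order sentences in twisted frames over complete graphs -/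

theorem exists_eq_var_inr {n : ℕ} (t : (frameLang Λ).Term (Empty ⊕ Fin n)) :
    ∃ k : Fin n, t = FirstOrder.Language.Term.var (Sum.inr k) := by
  rcases t with (a | k) | ⟨f, -⟩
  · exact a.elim
  · exact ⟨k, rfl⟩
  · exact f.elim

namespace Diagram.Base

variable {D : Diagram Λ} (B : D.Base) (e : D.W × Λ × D.W)

/-- The tuples `x` and `y` have the same first components, and their second components satisfy the
same equations. -/
def SameType {P I J : Type*} {n : ℕ} (x : Fin n → P × I) (y : Fin n → P × J) : Prop :=
  (∀ k, (x k).1 = (y k).1) ∧ ∀ k k', (x k).2 = (x k').2 ↔ (y k).2 = (y k').2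

theorem SameType.symm {P I J : Type*} {n : ℕ} {x : Fin n → P × I} {y : Fin n → P × J}
    (h : SameType x y) : SameType y x :=
  ⟨fun k => (h.1 k).symm, fun k k' => (h.2 k k').symm⟩

/-- The extension step of an Ehrenfeucht–Fraïssé game: an old index is matched by the corresponding
one, a new index by any unused one. -/
theorem SameType.exists_snoc {P I J : Type*} {n : ℕ} {x : Fin n → P × I} {y : Fin n → P × J}
    (h : SameType x y) (hJ : ∀ s : Finset J, s.card ≤ n → ∃ j, j ∉ s) (p : P × I) :
    ∃ q : P × J, SameType (Fin.snoc (α := fun _ => P × I) x p)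
      (Fin.snoc (α := fun _ => P × J) y q) := by
  classical
  have hj : ∃ j, ∀ k, (x k).2 = p.2 ↔ (y k).2 = j := by
    by_cases hp : ∃ k, (x k).2 = p.2
    · obtain ⟨k, hk⟩ := hp
      exact ⟨(y k).2, fun k' => by rw [← hk, h.2]⟩
    · obtain ⟨j, hj⟩ := hJ (Finset.univ.image fun k => (y k).2)
        (Finset.card_image_le.trans (by simp))
      refine ⟨j, fun k => ⟨fun hk => absurd ⟨k, hk⟩ hp, fun hk => absurd ?_ hj⟩⟩
      exact Finset.mem_image.2 ⟨k, Finset.mem_univ _, hk⟩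
  obtain ⟨j, hj⟩ := hj
  refine ⟨(p.1, j), fun k => ?_, fun k k' => ?_⟩
  · refine Fin.lastCases ?_ (fun k => ?_) k
    · simp
    · simpa using h.1 k
  · refine Fin.lastCases ?_ (fun k => ?_) k <;> refine Fin.lastCases ?_ (fun k' => ?_) k'
    · simp
    · simpa [eq_comm] using hj k'
    · simpa using hj k
    · simpa using h.2 k k'

theorem SameType.rel_iff {I J : Type} {n : ℕ} {x : Fin n → B.P × I} {y : Fin n → B.P × J}
    (h : SameType x y) (l : Λ) (k k' : Fin n) :
    (B.twist e (fun i j : I => i ≠ j)).R l (x k) (x k') ↔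
      (B.twist e (fun i j : J => i ≠ j)).R l (y k) (y k') := by
  simp only [twist, h.1, h.2, ne_eq]

/-- A bounded first-order formula does not distinguish between sufficiently large complete
graphs. -/
theorem exists_realize_iff {n : ℕ} (φ : (frameLang Λ).BoundedFormula Empty n) :
    ∃ N : ℕ, ∀ (I J : Type), (∀ s : Finset I, s.card ≤ N → ∃ i, i ∉ s) →
      (∀ s : Finset J, s.card ≤ N → ∃ i, i ∉ s) →
      ∀ (x : Fin n → B.P × I) (y : Fin n → B.P × J), SameType x y →
        (φ.Realize (M := (B.twist e (fun i j : I => i ≠ j)).W) default x ↔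
          φ.Realize (M := (B.twist e (fun i j : J => i ≠ j)).W) default y) := by
  induction φ with
  | falsum => exact ⟨0, fun _ _ _ _ _ _ _ => Iff.rfl⟩
  | equal t₁ t₂ =>
    refine ⟨0, fun I J _ _ x y h => ?_⟩
    obtain ⟨k, rfl⟩ := exists_eq_var_inr t₁
    obtain ⟨k', rfl⟩ := exists_eq_var_inr t₂
    show x k = x k' ↔ y k = y k'
    rw [Prod.ext_iff, Prod.ext_iff, h.1, h.1, h.2]
  | rel R ts =>
    refine ⟨0, fun I J _ _ x y h => ?_⟩
    cases R with
    | rel l =>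
      obtain ⟨k, hk⟩ := exists_eq_var_inr (ts 0)
      obtain ⟨k', hk'⟩ := exists_eq_var_inr (ts 1)
      have := h.rel_iff B e l k k'
      show (B.twist e (fun i j : I => i ≠ j)).R l ((ts 0).realize _) ((ts 1).realize _) ↔
        (B.twist e (fun i j : J => i ≠ j)).R l ((ts 0).realize _) ((ts 1).realize _)
      rw [hk, hk']
      exact this
  | imp _ _ h₁ h₂ =>
    obtain ⟨N₁, h₁⟩ := h₁
    obtain ⟨N₂, h₂⟩ := h₂
    refine ⟨max N₁ N₂, fun I J hI hJ x y h => imp_congr ?_ ?_⟩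
    · exact h₁ I J (fun s hs => hI s (hs.trans (le_max_left _ _)))
        (fun s hs => hJ s (hs.trans (le_max_left _ _))) x y h
    · exact h₂ I J (fun s hs => hI s (hs.trans (le_max_right _ _)))
        (fun s hs => hJ s (hs.trans (le_max_right _ _))) x y h
  | @all n _ ih =>
    obtain ⟨N, ih⟩ := ih
    refine ⟨max N n, fun I J hI hJ x y h => ?_⟩
    have ih' := ih I J (fun s hs => hI s (hs.trans (le_max_left _ _)))
      (fun s hs => hJ s (hs.trans (le_max_left _ _)))
    constructor
    · intro H q
      obtain ⟨p, hp⟩ := h.symm.exists_snoc (fun s hs => hI s (hs.trans (le_max_right _ _))) q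
      exact (ih' _ _ hp.symm).1 (H p)
    · intro H p
      obtain ⟨q, hq⟩ := h.exists_snoc (fun s hs => hJ s (hs.trans (le_max_right _ _))) p
      exact (ih' _ _ hq).2 (H q)

/-- A first-order sentence that is true in the twisted frame over the infinite complete graph is
true over some finite complete graph. -/
theorem exists_finite_mem_Mod (a : (frameLang Λ).Sentence)
    (h : B.twist e (fun i j : ℕ => i ≠ j) ∈ Mod a) :
    ∃ N : ℕ, B.twist e (fun i j : Fin (N + 1) => i ≠ j) ∈ Mod a := by
  obtain ⟨N, hN⟩ := B.exists_realize_iff e a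
  refine ⟨N, (hN ℕ (Fin (N + 1)) ?_ ?_ default default ⟨fun k => k.elim0, fun k => k.elim0⟩).1 h⟩
  · exact fun s _ => Infinite.exists_notMem_finset s
  · intro s hs
    by_contra hc
    push Not at hc
    have : s = Finset.univ := Finset.eq_univ_iff_forall.2 hc
    rw [this] at hs
    simp at hs

end Diagram.Base

/-! ### The logic of the diagram -/

theorem Axiomatises.mem_framesOf {S L : Set (ModalFormula Λ)} (h : Axiomatises S L)
    {F : Frame Λ} (hF : ∀ φ ∈ S, F.Valid φ) : F ∈ FramesOf L :=
  fun φ hφ => Frame.valid_normalLogic hF φ (h.subset_normalLogic hφ)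

theorem exists_bound_of_finite {α : Type*} {T : Set α} (hT : T.Finite) {P : α → ℕ → Prop}
    (hP : ∀ a ∈ T, ∃ m, ∀ n ≥ m, P a n) : ∃ m, ∀ a ∈ T, P a m := by
  have H : ∀ a, ∃ m, a ∈ T → ∀ n ≥ m, P a n := fun a => by
    by_cases ha : a ∈ T
    · obtain ⟨m, hm⟩ := hP a ha
      exact ⟨m, fun _ => hm⟩
    · exact ⟨0, fun h => absurd h ha⟩
  choose f hf using H
  obtain ⟨m, hm⟩ := (hT.image f).bddAbove
  exact ⟨m, fun a ha => hf a ha m (hm ⟨a, ha, rfl⟩)⟩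

namespace Diagram.Base

variable {D : Diagram Λ} (B : D.Base) {e : D.W × Λ × D.W}

theorem twist_nat_mem_framesOf : B.twist e (fun i j : ℕ => i ≠ j) ∈ FramesOf (Log D.frameClass) := by
  intro φ hφ
  obtain ⟨m, hm⟩ := B.exists_valid_twist e hφ
  refine hm _ _ fun c => ?_
  obtain ⟨i, j, hij, hc⟩ := Finite.exists_ne_map_eq_of_infinite c
  exact ⟨i, j, hij, hc⟩

theorem twist_nat_notMem_frameClass (hroot : D.Rooted) (he : D.IsCycleEdge e) :
    B.twist e (fun i j : ℕ => i ≠ j) ∉ D.frameClass := by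
  intro h
  obtain ⟨k, hk⟩ := exists_loop_of_homAt hroot he
    (D.mem_frameClass.1 h (B.ι D.root, (0 : ℕ)))
  exact hk rfl

theorem twist_fin_notMem_framesOf (hroot : D.Rooted) (he : D.IsCycleEdge e) (N : ℕ) :
    B.twist e (fun i j : Fin (N + 1) => i ≠ j) ∉ FramesOf (Log D.frameClass) := by
  intro h
  obtain ⟨χ, hL, hχ⟩ := B.exists_refuted_twist hroot he (N + 1) (Nat.succ_pos N)
  exact hχ (Fin (N + 1)) (fun i j => i ≠ j) ⟨0⟩ id (fun _ _ h => h) (h χ hL)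

open IsGraphTower in
/-- The logic of the diagram is not axiomatised by canonical formulas and a single formula. -/
theorem not_axiomatises_insert (B : D.Base) (hroot : D.Rooted) (he : D.IsCycleEdge e) (φ : ModalFormula Λ)
    (S : Set (ModalFormula Λ)) (hS : ∀ ψ ∈ S, Canonical ψ) :
    ¬ Axiomatises (insert φ S) (Log D.frameClass) := by
  intro hax
  -- The order of choices matters: `r` depends on `φ`, `χ` on `r`, and `m` on the finitely many
  -- axioms that derive `χ`. The complete graph on `r + 2` points keeps `φ` valid, while `r + 2`
  -- colours suffice for it together with the bipartite limit, so `χ` fails.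
  obtain ⟨r, hr⟩ := B.exists_valid_twist e (hax.subset (Set.mem_insert φ S))
  obtain ⟨χ, hχL, hχ⟩ := B.exists_refuted_twist hroot he (r + 2) (by omega)
  obtain ⟨T, hT, hTS, hTχ⟩ := exists_finite_of_mem_normalLogic (hax.subset_normalLogic hχL)
  obtain ⟨m, hm⟩ := exists_bound_of_finite hT (P := fun ψ n => ∀ (I : Type) (E : I → I → Prop),
      NotColourable E n → (B.twist e E).Valid ψ) fun ψ hψ => by
    obtain ⟨m, hm⟩ := B.exists_valid_twist e (hax.subset (hTS hψ))
    exact ⟨m, fun n hn I E hE => hm I E (hE.mono hn)⟩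
  obtain ⟨V, A, π, hV, hhard, hodd⟩ := exists_graphTower m
  have hlim := (hV.isGraphLimit_sum (J := Fin (r + 2)) (fun i j => i ≠ j)).twist B e
  obtain ⟨c, hc⟩ := hV.exists_limit_colouring hodd
  refine hχ _ (Sum.LiftRel (LimitAdj A) fun i j => i ≠ j) ⟨Sum.inr 0⟩
    (Sum.elim (fun x => Fin.castLE (by omega) (c x)) id) ?_
    (Frame.valid_normalLogic (fun ψ hψ => ?_) χ hTχ)
  · rintro _ _ (⟨hxy⟩ | ⟨hxy⟩)
    · exact fun h => hc _ _ hxy (Fin.castLE_injective (by omega : 2 ≤ r + 2) h)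
    · exact hxy
  · rcases hTS hψ with rfl | hψS
    · refine hr _ _ fun c => ?_
      have : ¬ Function.Injective fun i : Fin (r + 2) => c (Sum.inr i) := fun h => by
        have := Nat.card_le_card_of_injective _ h
        simp at this
      simp only [Function.Injective] at this
      push Not at this
      obtain ⟨i, j, hc, hij⟩ := this
      exact ⟨_, _, Sum.LiftRel.inr hij, hc⟩
    · refine hlim.valid_of_canonical (hS ψ hψS) fun k => hm ψ hψ _ _ fun c => ?_
      obtain ⟨i, j, hij, hc⟩ := hhard k fun v => c (Sum.inl v)
      exact ⟨_, _, Sum.LiftRel.inl hij, hc⟩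

end Diagram.Base

end ModalDiagram

theorem mainTheorem4 {Λ : Type u} (D : ModalDiagram.Diagram Λ) (hroot : D.Rooted)
    (hmin : D.GloballyMinimal) (hcyc : D.HasInnerCycle) :
    -- (i) local definability by a generalised Sahlqvist formula
    (¬ ∃ φ : ModalDiagram.ModalFormula Λ, φ.GeneralisedSahlqvist ∧
      ModalDiagram.LocallyDefines φ D.eFormula) ∧
    -- (ii) local modal definability
    (¬ ∃ φ : ModalDiagram.ModalFormula Λ, ModalDiagram.LocallyDefines φ D.eFormula) ∧
    -- (iii) global modal definability
    (¬ ∃ φ : ModalDiagram.ModalFormula Λ, ModalDiagram.GloballyDefines φ D.eSentence) ∧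
    -- (iv) axiomatisability by a generalised Sahlqvist formula
    (¬ ∃ φ : ModalDiagram.ModalFormula Λ, φ.GeneralisedSahlqvist ∧
      ModalDiagram.Axiomatises {φ} (ModalDiagram.Log D.frameClass)) ∧
    -- (v) finite axiomatisability
    (¬ ∃ S : Set (ModalDiagram.ModalFormula Λ), S.Finite ∧
      ModalDiagram.Axiomatises S (ModalDiagram.Log D.frameClass)) ∧
    -- (vi) axiomatisability using finitely many variables
    (¬ ∃ S : Set (ModalDiagram.ModalFormula Λ), (⋃ φ ∈ S, φ.vars).Finite ∧
      ModalDiagram.Axiomatises S (ModalDiagram.Log D.frameClass)) ∧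
    -- (vii) axiomatisability by canonical formulas
    (¬ ∃ S : Set (ModalDiagram.ModalFormula Λ), (∀ ψ ∈ S, ModalDiagram.Canonical ψ) ∧
      ModalDiagram.Axiomatises S (ModalDiagram.Log D.frameClass)) ∧
    -- (viii) axiomatisability by one formula and canonical formulas
    (¬ ∃ (φ : ModalDiagram.ModalFormula Λ) (S : Set (ModalDiagram.ModalFormula Λ)),
      (∀ ψ ∈ S, ModalDiagram.Canonical ψ) ∧
      ModalDiagram.Axiomatises (insert φ S) (ModalDiagram.Log D.frameClass)) ∧
    -- (ix) the frames of the logic are exactly the class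
    (¬ ModalDiagram.FramesOf (ModalDiagram.Log D.frameClass) = D.frameClass) ∧
    -- (x) the class of frames of the logic is elementary
    (¬ ModalDiagram.Elementary (ModalDiagram.FramesOf (ModalDiagram.Log D.frameClass))) := by
  obtain ⟨e, he⟩ := ModalDiagram.Diagram.exists_isCycleEdge hcyc
  obtain ⟨B⟩ := ModalDiagram.Diagram.exists_base hroot hmin
  have h9 : ¬ ModalDiagram.FramesOf (ModalDiagram.Log D.frameClass) = D.frameClass := fun h =>
    B.twist_nat_notMem_frameClass hroot he (h ▸ B.twist_nat_mem_framesOf)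
  have h3 : ¬ ∃ φ : ModalDiagram.ModalFormula Λ, ModalDiagram.GloballyDefines φ D.eSentence := by
    rintro ⟨φ, hφ⟩
    exact h9 (Set.Subset.antisymm (fun F hF => (hφ F).1 (hF φ fun G hG => (hφ G).2 hG))
      fun F hF ψ hψ => hψ F hF)
  have h2 : ¬ ∃ φ : ModalDiagram.ModalFormula Λ,
      ModalDiagram.LocallyDefines φ D.eFormula := by
    rintro ⟨φ, hφ⟩
    refine h3 ⟨φ, fun F => ?_⟩
    rw [D.realize_eSentence]
    exact forall_congr' fun w => (hφ F w).trans (D.realize_eFormula F w)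
  have h6 : ¬ ∃ S : Set (ModalDiagram.ModalFormula Λ), (⋃ φ ∈ S, φ.vars).Finite ∧
      ModalDiagram.Axiomatises S (ModalDiagram.Log D.frameClass) := by
    rintro ⟨S, hfin, hS⟩
    obtain ⟨m, hm⟩ := B.exists_valid_twist_of_vars e hfin
    exact B.twist_fin_notMem_framesOf hroot he m (hS.mem_framesOf fun φ hφ =>
      hm φ (hS.subset hφ) (Set.subset_biUnion_of_mem (u := fun φ => φ.vars) hφ))
  have h5 : ¬ ∃ S : Set (ModalDiagram.ModalFormula Λ), S.Finite ∧
      ModalDiagram.Axiomatises S (ModalDiagram.Log D.frameClass) := by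
    rintro ⟨S, hfin, hS⟩
    exact h6 ⟨S, hfin.biUnion fun φ _ => φ.finite_vars, hS⟩
  have h8 := fun φ S hS => B.not_axiomatises_insert hroot he φ S hS
  refine ⟨fun ⟨φ, _, hφ⟩ => h2 ⟨φ, hφ⟩, h2, h3,
    fun ⟨φ, _, hφ⟩ => h5 ⟨{φ}, Set.finite_singleton φ, hφ⟩, h5, h6, ?_,
    fun ⟨φ, S, hS, hax⟩ => h8 φ S hS hax, h9, ?_⟩
  · rintro ⟨S, hS, hax⟩
    -- Adding the trivial axiom `¬⊥` reduces this case to one formula plus canonical formulas.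
    have hbot : ModalDiagram.ModalFormula.neg ModalDiagram.ModalFormula.bot ∈
        ModalDiagram.Log D.frameClass := fun F _ w θ => id
    refine h8 _ S hS ⟨⟨hax.1.1, Set.insert_subset hbot hax.subset⟩, fun L' hL' => ?_⟩
    exact hax.2 ⟨hL'.1, (Set.subset_insert _ _).trans hL'.2⟩
  · rintro ⟨a, ha⟩
    obtain ⟨N, hN⟩ := B.exists_finite_mem_Mod e a (ha ▸ B.twist_nat_mem_framesOf)
    exact B.twist_fin_notMem_framesOf hroot he N (ha ▸ hN)
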